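/- **Theorem 1.5 (Doi–Onsager).** Let $\mathbb T=\mathbb R/\mathbb Z$ with Lebesgue measure $d\theta$, let $q_u\equiv 1$ be the uniform distribution, and let $W(\theta)=-|\sin(2\pi\theta)|$ be the two-dimensional Doi–Onsager kernel. For $K\ge 0$ and a Borel probability measure $q$ on $\mathbb T$ put $$\mathcal F_K(q)=\int_{\mathbb T}\log q\,dq-K\iint_{\mathbb T\times\mathbb T}W(\theta-\theta')\,dq(\theta)\,dq(\theta')\in(-\infty,\infty],$$ where the first term is the relative entropy of $q$ with respect to $q_u$ (equal to $+\infty$ if $q$ is not absolutely continuous). Let $\widehat W(k)=\int_{\mathbb T}W(\theta)e^{-2\pi i k\theta}\,d\theta$ and let $$K_\#=\frac{1}{2\max\{\widehat W(k): k\ge 1,\ \widehat W(k)>0\}}$$ be the linear stability threshold of $q_u$. Then $K_\#=3\pi/4$ (in particular, the maximum exists), and for $K_c=K_\#=3\pi/4$ the following hold. 1. (A phase transition occurs at $K_c$.) For $0\le K<K_c$, $q_u$ is the unique global minimizer of $\mathcal F_K$ among Borel probability measures; $q_u$ is a global minimizer of $\mathcal F_{K_c}$; and for every $K>K_c$ there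 is a global minimizer $q\ne q_u$ of $\mathcal F_K$. 2. (The phase transition is continuous.) The global minimizer of $\mathcal F_{K_c}$ is unique, and for every family $(q_K)_{K>K_c}$ such that each $q_K$ is a global minimizer of $\mathcal F_K$, $$\limsup_{K\to K_c+}\|q_K-q_u\|_{L^1(\mathbb T)}=0 .$$ -/

import Mathlib

open MeasureTheory Filter Topology

/-- The unit circle `ℝ / ℤ`. Its `volume` is the normalized Lebesgue measure. -/
abbrev Torus : Type := UnitAddCircle

namespace MeanField

/-- The uniform distribution on the circle (density `1`). -/
noncomputable def uniform : ProbabilityMeasure Torus :=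
  ⟨(volume : Measure Torus), ⟨UnitAddCircle.measure_univ⟩⟩

/-- The interaction energy `∬ W(θ - θ') dq(θ) dq(θ')`. As `W` is continuous on a compact space,
the integral always converges. -/
noncomputable def interactionEnergy (W : C(Torus, ℝ)) (q : ProbabilityMeasure Torus) : ℝ :=
  ∫ θ, ∫ θ', W (θ - θ') ∂(q : Measure Torus) ∂(q : Measure Torus)

/-- The free energy `∫ log q dq - K ∬ W(θ - θ') dq(θ) dq(θ')` of a Borel probability measure `q`.
The first term is the relative entropy of `q` with respect to the uniform distribution; it takes
the value `+∞` when `q` has no density, or when `log q` is not `q`-integrable. -/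
noncomputable def freeEnergy (W : C(Torus, ℝ)) (K : ℝ) (q : ProbabilityMeasure Torus) : EReal :=
  ((InformationTheory.klDiv (q : Measure Torus) volume : ENNReal) : EReal)
    - ((K * interactionEnergy W q : ℝ) : EReal)

/-- `q` minimizes the free energy among all Borel probability measures on the circle. -/
def IsGlobalMinimizer (W : C(Torus, ℝ)) (K : ℝ) (q : ProbabilityMeasure Torus) : Prop :=
  ∀ p : ProbabilityMeasure Torus, freeEnergy W K q ≤ freeEnergy W K p

/-- `Kc` is the critical coupling strength (the point of the phase transition) of `W`. -/
structure IsCriticalCoupling (W : C(Torus, ℝ)) (Kc : ℝ) : Prop where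
  pos : 0 < Kc
  /-- below `Kc` the uniform distribution is the unique global minimizer -/
  subcritical : ∀ K : ℝ, 0 ≤ K → K < Kc →
    ∀ q : ProbabilityMeasure Torus, IsGlobalMinimizer W K q ↔ q = uniform
  /-- at `Kc` the uniform distribution is a global minimizer -/
  critical : IsGlobalMinimizer W Kc uniform
  /-- above `Kc` there is a nonuniform global minimizer -/
  supercritical : ∀ K : ℝ, Kc < K →
    ∃ q : ProbabilityMeasure Torus, q ≠ uniform ∧ IsGlobalMinimizer W K q

/-- There is at most one critical coupling strength. -/
theorem IsCriticalCoupling.unique {W : C(Torus, ℝ)} {K₁ K₂ : ℝ}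
    (h₁ : IsCriticalCoupling W K₁) (h₂ : IsCriticalCoupling W K₂) : K₁ = K₂ := by
  have key : ∀ {a b : ℝ}, IsCriticalCoupling W a → IsCriticalCoupling W b → ¬ a < b := by
    intro a b ha hb hab
    obtain ⟨q, hq, hmin⟩ := ha.supercritical ((a + b) / 2) (by linarith)
    have hpos := ha.pos
    exact hq ((hb.subcritical ((a + b) / 2) (by linarith) (by linarith) q).1 hmin)
  exact le_antisymm (not_lt.1 (key h₂ h₁)) (not_lt.1 (key h₁ h₂))

/-- The `L¹` distance between the Lebesgue density of `q` and the uniform density `1`. It is only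
used for measures `q` of finite free energy, which are absolutely continuous. -/
noncomputable def l1DistUniform (q : ProbabilityMeasure Torus) : ENNReal :=
  eLpNorm (fun θ : Torus => ((q : Measure Torus).rnDeriv volume θ).toReal - 1) 1 volume

/-- The phase transition of `W` at `Kc` is continuous: the global minimizer at `Kc` is unique, and
every family of global minimizers `q K`, `K > Kc`, converges in `L¹` to the uniform distribution
as `K` decreases to `Kc`. -/
def IsContinuousTransition (W : C(Torus, ℝ)) (Kc : ℝ) : Prop :=
  (∃! q : ProbabilityMeasure Torus, IsGlobalMinimizer W Kc q) ∧
  ∀ q : ℝ → ProbabilityMeasure Torus, (∀ K : ℝ, Kc < K → IsGlobalMinimizer W K (q K)) →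
    limsup (fun K => l1DistUniform (q K)) (𝓝[>] Kc) = 0

/-- The Fourier coefficient `∫ W(θ) exp(-2πikθ) dθ`. It is real for even real `W`. (For a general
real `W` its real part is the coefficient of the even part of `W`, which is all that the free
energy depends on.) -/
noncomputable def coeff (W : C(Torus, ℝ)) (k : ℕ) : ℝ :=
  (fourierCoeff (fun θ : Torus => (W θ : ℂ)) (k : ℤ)).re

/-- `K` is the linear stability threshold `1 / (2 max Ŵ(k))` of the uniform distribution, where the
maximum is over the modes `k ≥ 1` with `Ŵ(k) > 0`. -/
def IsLinearStabilityThreshold (W : C(Torus, ℝ)) (K : ℝ) : Prop :=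
  ∃ m : ℝ, IsGreatest {x : ℝ | ∃ k : ℕ, 1 ≤ k ∧ 0 < coeff W k ∧ coeff W k = x} m ∧
    K = 1 / (2 * m)

theorem periodic_doiOnsager :
    Function.Periodic (fun θ : ℝ => -|Real.sin (2 * Real.pi * θ)|) 1 := by
  intro θ
  simp only [mul_add, mul_one, Real.sin_add_two_pi]

/-- The two-dimensional Doi–Onsager kernel `θ ↦ -|sin (2πθ)|`. -/
noncomputable def doiOnsager : C(Torus, ℝ) where
  toFun := periodic_doiOnsager.lift
  continuous_toFun := by
    refine continuous_quot_lift _ ?_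
    fun_prop

theorem doiOnsager_coe (θ : ℝ) : doiOnsager (θ : Torus) = -|Real.sin (2 * Real.pi * θ)| := rfl

end MeanField

/-! Write m_k = ∫ exp(4πikθ) dq for k ≥ 1. The odd Fourier coefficients of the kernel vanish and the
even ones are explicit, so up to an additive constant the free energy is Ent(q) − (K/K_c)·E(q),
where K_c = 3π/4 and E(q) = Σ 3/(4k²−1)·|m_k|² (`excess`). Everything at or below K_c reduces to E ≤
Ent with a quantitative equality case. The inequality follows from the logarithmic
Hardy–Littlewood–Sobolev inequality Σ |m_k|²/k ≤ Ent(q), since 3/(4k²−1) ≤ 1/k with equality only at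
k = 1. It is dual to the Lebedev–Milin inequality: the Donsker–Varadhan bound is applied to 2 Re
P(exp(4πiθ)), Parseval turns the exponential integral into the sum of squared Taylor coefficients of
exp P, and Lebedev–Milin bounds that sum by exp(Σ k|P_k|²). For k ≥ 2 the coefficient 3/(4k²−1) is
even at most 1/(2k), so a near-equality puts almost all the entropy into |m_1|²
(`excess_le_half_add`). A sharper bound for that single mode (`two_mul_sub_log_le_entropy`) then
forces m_1, hence Ent, to be small (`entropy_le_of_le_excess_add`). This gives uniqueness at K_c
and, through a Pinsker-type bound, continuity of the transition. Above K_c a small perturbation in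
the first mode lowers the energy. Minimizers exist because a weakly continuous dual functional on a
compact space lies between the free energies of q and of its Gibbs measure. -/

namespace MeanField

/-! ### Taylor coefficients of exponentials and the Lebedev–Milin inequality. -/

open Polynomial in
/-- The Taylor coefficients at `0` of `w ↦ exp (P w)`. -/
noncomputable def expCoeff (P : ℂ[X]) (n : ℕ) : ℂ :=
  (n.factorial : ℂ)⁻¹ * iteratedDeriv n (fun w => Complex.exp (P.eval w)) 0

section LebedevMilin

open Polynomial

theorem hasSum_expCoeff (P : ℂ[X]) (w : ℂ) :
    HasSum (fun n => expCoeff P n * w ^ n) (Complex.exp (P.eval w)) := by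
  have h : Differentiable ℂ fun w => Complex.exp (P.eval w) := P.differentiable.cexp
  have := Complex.hasSum_taylorSeries_of_entire h 0 w
  refine this.congr_fun fun n => ?_
  simp only [expCoeff, smul_eq_mul, sub_zero]
  ring

theorem summable_norm_expCoeff (P : ℂ[X]) : Summable fun n => ‖expCoeff P n‖ := by
  have := (hasSum_expCoeff P 1).summable.norm
  simpa using this

theorem expCoeff_zero {P : ℂ[X]} (h : P.coeff 0 = 0) : expCoeff P 0 = 1 := by
  simp [expCoeff, ← coeff_zero_eq_eval_zero, h]

theorem iteratedDeriv_eval_zero (P : ℂ[X]) (n : ℕ) :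
    iteratedDeriv n (fun w => P.eval w) 0 = n.factorial * P.coeff n := by
  have h : iteratedDeriv n (fun w => P.eval w) = fun w => (derivative^[n] P).eval w := by
    induction n with
    | zero => simp
    | succ n ih =>
      rw [iteratedDeriv_succ, ih, Function.iterate_succ_apply']
      funext w
      exact Polynomial.deriv _
  rw [h]
  simp only [← coeff_zero_eq_eval_zero]
  rw [coeff_iterate_derivative]
  simp [Nat.descFactorial_self]

/-- Leibniz's rule at 0 applied to (exp P)′ = P′ exp P. -/
theorem expCoeff_succ (P : ℂ[X]) (n : ℕ) :
    ((n + 1 : ℕ) : ℂ) * expCoeff P (n + 1) =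
      ∑ i ∈ Finset.range (n + 1), ((i + 1 : ℕ) : ℂ) * P.coeff (i + 1) * expCoeff P (n - i) := by
  have hd : deriv (fun w => Complex.exp (P.eval w)) =
      fun w => P.derivative.eval w * Complex.exp (P.eval w) := by
    funext w
    rw [(P.hasDerivAt w).cexp.deriv, mul_comm]
  have hn : ((n + 1 : ℕ) : ℂ) ≠ 0 := by exact_mod_cast n.succ_ne_zero
  have hn' : (n.factorial : ℂ) ≠ 0 := by exact_mod_cast n.factorial_ne_zero
  have hP : ContDiffAt ℂ n (fun w => P.derivative.eval w) 0 := by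
    have := P.derivative.contDiff_aeval (𝕜 := ℂ) (n := n)
    simpa using this.contDiffAt
  have hE : ContDiffAt ℂ n (fun w => Complex.exp (P.eval w)) 0 := by
    have := (P.contDiff_aeval (𝕜 := ℂ) (n := n)).cexp
    simpa using this.contDiffAt
  rw [expCoeff, iteratedDeriv_succ', hd, iteratedDeriv_fun_mul hP hE, Nat.factorial_succ]
  push_cast
  rw [mul_inv, mul_assoc, mul_inv_cancel_left₀ (by exact_mod_cast hn), Finset.mul_sum]
  refine Finset.sum_congr rfl fun i hi => ?_
  have hi' : i ≤ n := Nat.lt_succ_iff.1 (Finset.mem_range.1 hi)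
  rw [iteratedDeriv_eval_zero, coeff_derivative, expCoeff, Nat.choose_eq_factorial_div_factorial hi',
    Nat.cast_div (Nat.factorial_mul_factorial_dvd_factorial hi')]
  · have h1 : (i.factorial : ℂ) ≠ 0 := by exact_mod_cast i.factorial_ne_zero
    have h2 : ((n - i).factorial : ℂ) ≠ 0 := by exact_mod_cast (n - i).factorial_ne_zero
    push_cast
    field_simp
  · exact_mod_cast mul_ne_zero i.factorial_ne_zero (n - i).factorial_ne_zero

/-- Coefficientwise comparison of `exp P` with `exp` of the polynomial with coefficients
`k ‖P.coeff k‖²`. -/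
theorem exists_expCoeff_eq_ofReal {P Q : ℂ[X]} (hP : P.coeff 0 = 0)
    (hQ : ∀ k, Q.coeff k = ((k * ‖P.coeff k‖ ^ 2 : ℝ) : ℂ)) (n : ℕ) :
    ∃ r : ℝ, expCoeff Q n = r ∧ ‖expCoeff P n‖ ^ 2 ≤ r := by
  induction n using Nat.strong_induction_on with
  | _ n ih =>
  rcases n with _ | n
  · exact ⟨1, by rw [expCoeff_zero] <;> simp [hQ], by rw [expCoeff_zero hP]; simp⟩
  choose! r hr hle using ih
  have hn : (0 : ℝ) < ((n + 1 : ℕ) : ℝ) := by positivity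
  have hlt : ∀ i, n - i < n + 1 := fun i => by omega
  set S : ℝ := ∑ i ∈ Finset.range (n + 1),
    ((i + 1 : ℕ) : ℝ) * ((i + 1 : ℕ) * ‖P.coeff (i + 1)‖ ^ 2) * r (n - i) with hS
  have hQn : ((n + 1 : ℕ) : ℂ) * expCoeff Q (n + 1) = (S : ℂ) := by
    rw [expCoeff_succ, hS]
    push_cast
    refine Finset.sum_congr rfl fun i _ => ?_
    rw [hQ, hr _ (hlt i)]
    push_cast
    ring
  refine ⟨S / (n + 1 : ℕ), ?_, ?_⟩
  · rw [Complex.ofReal_div, ← hQn]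
    push_cast
    have : (n + 1 : ℂ) ≠ 0 := by exact_mod_cast n.succ_ne_zero
    field_simp
  · have h1 : ((n + 1 : ℕ) : ℝ) * ‖expCoeff P (n + 1)‖ ≤ ∑ i ∈ Finset.range (n + 1),
        ((i + 1 : ℕ) : ℝ) * ‖P.coeff (i + 1)‖ * ‖expCoeff P (n - i)‖ := by
      have := norm_sum_le (Finset.range (n + 1)) fun i =>
        ((i + 1 : ℕ) : ℂ) * P.coeff (i + 1) * expCoeff P (n - i)
      rw [← expCoeff_succ] at this
      simpa only [norm_mul, RCLike.norm_natCast] using this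
    -- Cauchy–Schwarz over n + 1 terms. The factor n + 1 is the one in the recurrence for exp Q, and
    -- the squares (i+1)²‖P_{i+1}‖² are its coefficients; this dictates the choice of Q.
    have h2 : (((n + 1 : ℕ) : ℝ) * ‖expCoeff P (n + 1)‖) ^ 2 ≤ ((n + 1 : ℕ) : ℝ) * S := by
      calc _ ≤ (∑ i ∈ Finset.range (n + 1),
            ((i + 1 : ℕ) : ℝ) * ‖P.coeff (i + 1)‖ * ‖expCoeff P (n - i)‖) ^ 2 := by gcongr
        _ ≤ ((Finset.range (n + 1)).card : ℝ) * ∑ i ∈ Finset.range (n + 1),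
            (((i + 1 : ℕ) : ℝ) * ‖P.coeff (i + 1)‖ * ‖expCoeff P (n - i)‖) ^ 2 :=
          sq_sum_le_card_mul_sum_sq
        _ ≤ _ := by
          rw [Finset.card_range, hS]
          gcongr with i
          calc _ = ((i + 1 : ℕ) : ℝ) * ((i + 1 : ℕ) * ‖P.coeff (i + 1)‖ ^ 2) *
                ‖expCoeff P (n - i)‖ ^ 2 := by ring
            _ ≤ _ := by gcongr; exact hle _ (hlt i)
    rw [le_div_iff₀ hn]
    have h3 : ((n + 1 : ℕ) : ℝ) * (‖expCoeff P (n + 1)‖ ^ 2 * (n + 1 : ℕ)) ≤ (n + 1 : ℕ) * S := by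
      linarith
    exact le_of_mul_le_mul_left h3 hn

/-- The first Lebedev–Milin inequality. -/
theorem tsum_norm_expCoeff_sq_le {P : ℂ[X]} {N : ℕ} (hP : P.coeff 0 = 0) (hN : P.natDegree < N) :
    Summable (fun n => ‖expCoeff P n‖ ^ 2) ∧ ∑' n, ‖expCoeff P n‖ ^ 2 ≤
      Real.exp (∑ k ∈ Finset.range N, (k : ℝ) * ‖P.coeff k‖ ^ 2) := by
  set Q : ℂ[X] := ∑ k ∈ Finset.range N, monomial k ((k * ‖P.coeff k‖ ^ 2 : ℝ) : ℂ) with hQ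
  have hQc : ∀ k, Q.coeff k = ((k * ‖P.coeff k‖ ^ 2 : ℝ) : ℂ) := by
    intro k
    simp only [hQ, finsetSum_coeff, coeff_monomial, Finset.sum_ite_eq', Finset.mem_range]
    split_ifs with h
    · rfl
    · rw [coeff_eq_zero_of_natDegree_lt (by omega)]; simp
  choose r hr hle using exists_expCoeff_eq_ofReal hP hQc
  have hsum : HasSum r (Real.exp (∑ k ∈ Finset.range N, (k : ℝ) * ‖P.coeff k‖ ^ 2)) := by
    -- Evaluating exp Q at 1 sums the majorants exactly.
    have := hasSum_expCoeff Q 1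
    simp only [hr, one_pow, mul_one] at this
    have he : Q.eval 1 = ((∑ k ∈ Finset.range N, (k : ℝ) * ‖P.coeff k‖ ^ 2 : ℝ) : ℂ) := by
      simp [hQ, eval_finsetSum]
    rw [he, ← Complex.ofReal_exp] at this
    exact_mod_cast this
  have hs : Summable (fun n => ‖expCoeff P n‖ ^ 2) :=
    hsum.summable.of_nonneg_of_le (fun _ => by positivity) hle
  exact ⟨hs, hasSum_le hle hs.hasSum hsum⟩

end LebedevMilin

/-! ### Relative entropy: variational bound, Gibbs measures, Pinsker, Taylor bound. -/

section Entropy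

open InformationTheory

variable {α : Type*} [MeasurableSpace α]

/-- The Donsker–Varadhan lower bound for the relative entropy. -/
theorem integral_sub_log_integral_exp_le_klDiv {μ ν : Measure α} [IsProbabilityMeasure μ]
    [IsProbabilityMeasure ν] (h : klDiv μ ν ≠ ⊤) {f : α → ℝ} (hf : Integrable f μ)
    (hf' : Integrable (fun x => Real.exp (f x)) ν) :
    ∫ x, f x ∂μ - Real.log (∫ x, Real.exp (f x) ∂ν) ≤ (klDiv μ ν).toReal := by
  obtain ⟨hac, hint⟩ := klDiv_ne_top_iff.1 h
  have := isProbabilityMeasure_tilted hf'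
  have h1 := integral_llr_add_sub_measure_univ_nonneg
    (hac.trans (absolutelyContinuous_tilted hf')) (integrable_llr_tilted_right hac hf hint hf')
  rw [integral_llr_tilted_right hac hf hf' hint] at h1
  rw [toReal_klDiv_of_measure_eq hac (by simp)]
  simp only [probReal_univ] at h1
  linarith

/-- The relative entropy of a Gibbs measure with bounded potential. -/
theorem klDiv_tilted {ν : Measure α} [IsProbabilityMeasure ν] {f : α → ℝ} (hf : Measurable f)
    {C : ℝ} (hC : ∀ x, |f x| ≤ C) :
    klDiv (ν.tilted f) ν ≠ ⊤ ∧ (klDiv (ν.tilted f) ν).toReal =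
      ∫ x, f x ∂(ν.tilted f) - Real.log (∫ x, Real.exp (f x) ∂ν) := by
  have hf' : Integrable (fun x => Real.exp (f x)) ν := by
    refine Integrable.of_bound hf.exp.aestronglyMeasurable (Real.exp C) (ae_of_all _ fun x => ?_)
    rw [Real.norm_eq_abs, Real.abs_exp]
    exact Real.exp_le_exp.2 ((le_abs_self _).trans (hC x))
  have := isProbabilityMeasure_tilted hf'
  have hfi : Integrable f (ν.tilted f) :=
    Integrable.of_bound hf.aestronglyMeasurable C (ae_of_all _ hC)
  have hac := tilted_absolutelyContinuous ν f
  have hae : llr (ν.tilted f) ν =ᵐ[ν.tilted f]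
      fun x => f x - Real.log (∫ x, Real.exp (f x) ∂ν) :=
    hac.ae_le (log_rnDeriv_tilted_left_self hf')
  have hint : Integrable (llr (ν.tilted f) ν) (ν.tilted f) :=
    (integrable_congr hae).2 (hfi.sub (integrable_const _))
  refine ⟨klDiv_ne_top hac hint, ?_⟩
  rw [toReal_klDiv_of_measure_eq hac (by simp), integral_congr_ae hae,
    integral_sub hfi (integrable_const _)]
  simp

/-- A weak form of Pinsker's inequality. -/
theorem mul_integral_abs_rnDeriv_sub_one_le {μ ν : Measure α} [IsProbabilityMeasure μ]
    [IsProbabilityMeasure ν] (h : klDiv μ ν ≠ ⊤) {t : ℝ} (ht : 0 ≤ t) (ht1 : t ≤ 1) :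
    t * ∫ x, |(μ.rnDeriv ν x).toReal - 1| ∂ν ≤ (klDiv μ ν).toReal + t ^ 2 := by
  obtain ⟨hac, hint⟩ := klDiv_ne_top_iff.1 h
  set ρ : α → ℝ := fun x => (μ.rnDeriv ν x).toReal with hρ
  have hρm : Measurable ρ := (μ.measurable_rnDeriv ν).ennreal_toReal
  have hρi : Integrable ρ ν := Measure.integrable_toReal_rnDeriv
  -- Test function tσ with σ = sign(ρ − 1), for which the difference of its means under μ and ν is t
  -- times the L¹ distance.
  set σ : α → ℝ := fun x => if 1 ≤ ρ x then 1 else -1 with hσ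
  have hσm : Measurable σ :=
    Measurable.ite (measurableSet_le measurable_const hρm) measurable_const measurable_const
  have hσb : ∀ x, |σ x| ≤ 1 := fun x => by simp only [hσ]; split_ifs <;> simp
  have hσν : Integrable σ ν := Integrable.of_bound hσm.aestronglyMeasurable 1 (ae_of_all _ hσb)
  have hσμ : Integrable σ μ := Integrable.of_bound hσm.aestronglyMeasurable 1 (ae_of_all _ hσb)
  have hexpm : Integrable (fun x => Real.exp (t * σ x)) ν := by
    refine Integrable.of_bound (hσm.const_mul t).exp.aestronglyMeasurable (Real.exp 1)
      (ae_of_all _ fun x => ?_)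
    rw [Real.norm_eq_abs, Real.abs_exp]
    refine Real.exp_le_exp.2 ((le_abs_self _).trans ?_)
    rw [abs_mul, abs_of_nonneg ht]
    nlinarith [hσb x, abs_nonneg (σ x)]
  have hdv := integral_sub_log_integral_exp_le_klDiv h (hσμ.const_mul t) hexpm
  have hlin : Integrable (fun x => 1 + t * σ x) ν := (integrable_const _).add (hσν.const_mul t)
  -- Integrates exp y ≤ 1 + y + y², valid for |y| ≤ 1.
  have hexp : ∫ x, Real.exp (t * σ x) ∂ν ≤ 1 + t * ∫ x, σ x ∂ν + t ^ 2 := by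
    have h1 : ∫ x, (1 + t * σ x + t ^ 2) ∂ν = 1 + t * ∫ x, σ x ∂ν + t ^ 2 := by
      rw [integral_add hlin (integrable_const _),
        integral_add (integrable_const _) (hσν.const_mul t), integral_const_mul]
      simp
    rw [← h1]
    refine integral_mono hexpm
      (hlin.add (integrable_const _)) fun x => ?_
    have hx : |t * σ x| ≤ 1 := by
      rw [abs_mul, abs_of_nonneg ht]; nlinarith [hσb x, abs_nonneg (σ x)]
    have h2 := (abs_le.1 (Real.abs_exp_sub_one_sub_id_le hx)).2
    have h3 : (t * σ x) ^ 2 ≤ t ^ 2 := by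
      rw [mul_pow]; nlinarith [sq_nonneg t, (sq_le_one_iff_abs_le_one _).2 (hσb x)]
    simp only
    linarith
  have hpos : 0 < ∫ x, Real.exp (t * σ x) ∂ν := integral_exp_pos hexpm
  have hlog := Real.log_le_sub_one_of_pos hpos
  have hL : ∫ x, |ρ x - 1| ∂ν = ∫ x, σ x ∂μ - ∫ x, σ x ∂ν := by
    rw [← integral_rnDeriv_smul hac, ← integral_sub]
    · refine integral_congr_ae (ae_of_all _ fun x => ?_)
      simp only [hσ, smul_eq_mul]
      split_ifs with hx
      · rw [abs_of_nonneg (by linarith)]; simp [hρ]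
      · rw [abs_of_nonpos (by linarith)]; simp [hρ]; ring
    · refine hρi.mul_bdd (c := 1) hσm.aestronglyMeasurable (ae_of_all _ hσb)
    · exact hσν
  rw [integral_const_mul] at hdv
  rw [hL]
  linarith

/-- Second-order Taylor bound. The sharp constant 1/2 matters: above the threshold the quadratic
terms of entropy and interaction are compared exactly. -/
theorem klFun_one_add_le {x : ℝ} (hx : |x| ≤ 1 / 2) :
    klFun (1 + x) ≤ x ^ 2 / 2 + 4 * |x| ^ 3 := by
  have h := Real.abs_log_sub_add_sum_range_le (x := -x) (by rw [abs_neg]; linarith) 2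
  simp only [Finset.sum_range_succ, Finset.sum_range_zero, abs_neg, sub_neg_eq_add] at h
  norm_num at h
  have h2 : |x| ^ 3 / (1 - |x|) ≤ 2 * |x| ^ 3 := by
    rw [div_le_iff₀ (by linarith)]
    nlinarith [pow_nonneg (abs_nonneg x) 3]
  have h3 := (abs_le.1 (h.trans h2)).2
  have h4 : Real.log (1 + x) ≤ x - x ^ 2 / 2 + 2 * |x| ^ 3 := by linarith
  obtain ⟨h5, h6⟩ := abs_le.1 hx
  have h7 : -x ^ 3 ≤ |x| ^ 3 := by rw [← abs_pow]; exact neg_le_abs _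
  have h8 := mul_le_mul_of_nonneg_left h4 (by linarith : 0 ≤ 1 + x)
  have h9 : 0 ≤ |x| ^ 3 := by positivity
  rw [klFun_apply]
  nlinarith

end Entropy

/-! ### Even Fourier modes and the logarithmic Hardy–Littlewood–Sobolev inequality. -/

section Modes

open Polynomial

instance : IsProbabilityMeasure (volume : Measure Torus) := ⟨UnitAddCircle.measure_univ⟩

theorem integral_fourier (n : ℤ) :
    ∫ θ : Torus, fourier n θ = if n = 0 then (1 : ℂ) else 0 := by
  have h := congrFun (fourierCoeff_fourier (T := (1 : ℝ)) n) 0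
  rw [fourierCoeff] at h
  simp only [neg_zero, fourier_zero, one_smul, Pi.single_apply] at h
  rw [AddCircle.integral_haarAddCircle] at h
  simpa [eq_comm] using h

theorem fourier_two_pow (n : ℕ) (θ : Torus) :
    fourier 2 θ ^ n = (fourier (2 * n : ℤ) θ : ℂ) := by
  rw [fourier_apply, fourier_apply, ← Circle.coe_pow, ← AddCircle.toCircle_nsmul, ← natCast_zsmul,
    smul_smul, mul_comm]

theorem norm_fourier_apply (n : ℤ) (θ : Torus) : ‖(fourier n θ : ℂ)‖ = 1 := by
  rw [fourier_apply, Circle.norm_coe]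

/-- Parseval's identity for an absolutely convergent power series in `fourier 2`. -/
theorem hasSum_norm_sq_of_hasSum {b : ℕ → ℂ} (hb : Summable fun n => ‖b n‖) {h : C(Torus, ℂ)}
    (hh : ∀ θ, HasSum (fun n => b n * fourier 2 θ ^ n) (h θ)) :
    HasSum (fun n => ‖b n‖ ^ 2) (∫ θ, ‖h θ‖ ^ 2) := by
  have hz : ∀ (n : ℕ) (θ : Torus), ‖(fourier 2 θ : ℂ) ^ n‖ = 1 := fun n θ => by
    rw [norm_pow, norm_fourier_apply, one_pow]
  have coeff_eq : ∀ n : ℕ, ∫ θ, starRingEnd ℂ (h θ) * fourier 2 θ ^ n = starRingEnd ℂ (b n) := by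
    intro n
    have h1 := hasSum_integral_of_summable_integral_norm (μ := (volume : Measure Torus))
      (F := fun k θ => starRingEnd ℂ (b k * fourier 2 θ ^ k) * fourier 2 θ ^ n)
      (fun k => (Continuous.integrable_of_hasCompactSupport (by fun_prop)
        (HasCompactSupport.of_compactSpace _)))
      (by
        simp only [norm_mul, RCLike.norm_conj, hz, mul_one]
        simpa using hb)
    have h2 : ∀ k, ∫ θ : Torus, starRingEnd ℂ (b k * fourier 2 θ ^ k) * fourier 2 θ ^ n =
        if k = n then starRingEnd ℂ (b n) else 0 := by
      intro k
      have : ∀ θ : Torus, starRingEnd ℂ (b k * fourier 2 θ ^ k) * fourier 2 θ ^ n =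
          starRingEnd ℂ (b k) * fourier (2 * n - 2 * k : ℤ) θ := by
        intro θ
        rw [map_mul, fourier_two_pow, fourier_two_pow, ← fourier_neg, mul_assoc, ← fourier_add]
        congr 3
        ring
      simp only [this]
      rw [integral_const_mul, integral_fourier]
      by_cases hk : k = n
      · simp [hk]
      · rw [if_neg hk, if_neg (by omega), mul_zero]
    simp only [h2] at h1
    have h3 : ∀ θ : Torus, ∑' k, starRingEnd ℂ (b k * fourier 2 θ ^ k) * fourier 2 θ ^ n =
        starRingEnd ℂ (h θ) * fourier 2 θ ^ n := fun θ =>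
      (((Complex.hasSum_conj').2 (hh θ)).mul_right _).tsum_eq
    simp only [h3] at h1
    exact h1.unique (hasSum_ite_eq n _)
  have h1 := hasSum_integral_of_summable_integral_norm (μ := (volume : Measure Torus))
    (F := fun n θ => starRingEnd ℂ (h θ) * (b n * fourier 2 θ ^ n))
    (fun k => (Continuous.integrable_of_hasCompactSupport (by fun_prop)
        (HasCompactSupport.of_compactSpace _)))
    (by
      simp only [norm_mul, RCLike.norm_conj, hz, mul_one, integral_mul_const]
      exact hb.mul_left _)
  have h2 : ∀ n, ∫ θ, starRingEnd ℂ (h θ) * (b n * fourier 2 θ ^ n) = ((‖b n‖ ^ 2 : ℝ) : ℂ) := by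
    intro n
    have : ∀ θ, starRingEnd ℂ (h θ) * (b n * fourier 2 θ ^ n) =
      b n * (starRingEnd ℂ (h θ) * fourier 2 θ ^ n) := fun θ => by ring
    simp only [this]
    rw [integral_const_mul, coeff_eq, Complex.mul_conj']
    push_cast; rfl
  have h3 : ∀ θ, ∑' n, starRingEnd ℂ (h θ) * (b n * fourier 2 θ ^ n) =
      ((‖h θ‖ ^ 2 : ℝ) : ℂ) := fun θ => by
    rw [((hh θ).mul_left _).tsum_eq, mul_comm, Complex.mul_conj']
    push_cast; rfl
  simp only [h2, h3] at h1
  rw [integral_complex_ofReal] at h1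
  exact_mod_cast h1

/-- Parseval for exp P on the circle, using |exp P|² = exp(2 Re P). -/
theorem hasSum_norm_expCoeff_sq (P : ℂ[X]) :
    HasSum (fun n => ‖expCoeff P n‖ ^ 2)
      (∫ θ : Torus, Real.exp (2 * (P.eval (fourier 2 θ)).re)) := by
  have h := hasSum_norm_sq_of_hasSum (summable_norm_expCoeff P)
    (h := ⟨fun θ => Complex.exp (P.eval (fourier 2 θ)),
      (P.continuous.comp (map_continuous (fourier 2))).cexp⟩)
    (fun θ => hasSum_expCoeff P _)
  convert h using 4 with θ
  simp only [ContinuousMap.coe_mk]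
  rw [Complex.norm_exp, ← Real.exp_nat_mul]
  norm_num

/-- The Fourier mode `2 (j + 1)` of a measure on the circle. -/
noncomputable def mode (q : ProbabilityMeasure Torus) (j : ℕ) : ℂ :=
  ∫ θ, fourier (2 * (j + 1 : ℕ) : ℤ) θ ∂(q : Measure Torus)

theorem norm_mode_le (q : ProbabilityMeasure Torus) (j : ℕ) : ‖mode q j‖ ≤ 1 := by
  have := norm_integral_le_of_norm_le_const (μ := (q : Measure Torus)) (C := 1)
    (f := fun θ => (fourier (2 * (j + 1 : ℕ) : ℤ) θ : ℂ))
    (ae_of_all _ fun θ => (norm_fourier_apply _ θ).le)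
  simpa [mode] using this

/-- The relative entropy with respect to the uniform distribution, as a real number. -/
noncomputable def entropy (q : ProbabilityMeasure Torus) : ℝ :=
  (InformationTheory.klDiv (q : Measure Torus) volume).toReal

theorem integrable_of_continuous {E : Type*} [NormedAddCommGroup E]
    {μ : Measure Torus} [IsFiniteMeasure μ] {f : Torus → E} (hf : Continuous f) :
    Integrable f μ :=
  hf.integrable_of_hasCompactSupport (HasCompactSupport.of_compactSpace _)

/-- Donsker–Varadhan with test function 2 Re P, its exponential integral rewritten by Parseval. -/
theorem re_integral_eval_sub_log_le_entropy {q : ProbabilityMeasure Torus}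
    (hq : InformationTheory.klDiv (q : Measure Torus) volume ≠ ⊤) (P : ℂ[X]) :
    2 * (∫ θ, P.eval (fourier 2 θ) ∂(q : Measure Torus)).re -
      Real.log (∑' n, ‖expCoeff P n‖ ^ 2) ≤ entropy q := by
  have hc : Continuous fun θ : Torus => P.eval (fourier 2 θ) :=
    P.continuous.comp (map_continuous (fourier 2))
  have hc' : Continuous fun θ : Torus => 2 * (P.eval (fourier 2 θ)).re :=
    continuous_const.mul (Complex.continuous_re.comp hc)
  have h := integral_sub_log_integral_exp_le_klDiv hq (integrable_of_continuous hc')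
    (integrable_of_continuous hc'.rexp)
  rw [(hasSum_norm_expCoeff_sq P).tsum_eq]
  rw [integral_const_mul] at h
  have hre : (∫ θ, P.eval (fourier 2 θ) ∂(q : Measure Torus)).re =
      ∫ θ, (P.eval (fourier 2 θ)).re ∂(q : Measure Torus) :=
    (integral_re (integrable_of_continuous hc)).symm
  rw [hre]
  exact h

/-- The logarithmic Hardy–Littlewood–Sobolev inequality on the circle. -/
theorem sum_norm_mode_sq_div_le_entropy {q : ProbabilityMeasure Torus}
    (hq : InformationTheory.klDiv (q : Measure Torus) volume ≠ ⊤) (N : ℕ) :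
    ∑ j ∈ Finset.range N, ‖mode q j‖ ^ 2 / (j + 1 : ℕ) ≤ entropy q := by
  -- These coefficients maximize 2 Re Σ P_k m_k − Σ k|P_k|². The pairing Σ P_k m_k and the
  -- Lebedev–Milin exponent both equal S, leaving 2S − S.
  set P : ℂ[X] := ∑ j ∈ Finset.range N,
    monomial (j + 1) (starRingEnd ℂ (mode q j) / (j + 1 : ℕ)) with hP
  have hcoeff : ∀ k, P.coeff (k + 1) = if k < N then starRingEnd ℂ (mode q k) / (k + 1 : ℕ) else 0 := by
    intro k
    simp [hP, finsetSum_coeff, coeff_monomial, Finset.sum_ite_eq']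
  have h0 : P.coeff 0 = 0 := by simp [hP, finsetSum_coeff, coeff_monomial]
  have hdeg : P.natDegree < N + 1 := by
    refine Nat.lt_succ_of_le (natDegree_sum_le_of_forall_le _ _ fun j hj => ?_)
    exact (natDegree_monomial_le _).trans (Finset.mem_range.1 hj)
  set S : ℝ := ∑ j ∈ Finset.range N, ‖mode q j‖ ^ 2 / (j + 1 : ℕ) with hS
  have hLM := (tsum_norm_expCoeff_sq_le h0 hdeg).2
  have hexp : ∑ k ∈ Finset.range (N + 1), (k : ℝ) * ‖P.coeff k‖ ^ 2 = S := by
    rw [Finset.sum_range_succ', hS]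
    simp only [Nat.cast_zero, zero_mul, add_zero]
    refine Finset.sum_congr rfl fun j hj => ?_
    rw [hcoeff, if_pos (Finset.mem_range.1 hj), norm_div, RCLike.norm_conj, RCLike.norm_natCast]
    have : ((j + 1 : ℕ) : ℝ) ≠ 0 := by positivity
    field_simp
  have hint : ∫ θ, P.eval (fourier 2 θ) ∂(q : Measure Torus) = S := by
    simp only [hP, eval_finsetSum, eval_monomial, fourier_two_pow]
    rw [integral_finsetSum _ fun j _ => integrable_of_continuous (by fun_prop), hS]
    push_cast
    refine Finset.sum_congr rfl fun j _ => ?_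
    rw [integral_const_mul]
    have := Complex.conj_mul' (mode q j)
    rw [div_mul_eq_mul_div, ← this]
    simp [mode]
  have h := re_integral_eval_sub_log_le_entropy hq P
  have hpos : 0 < ∑' n, ‖expCoeff P n‖ ^ 2 := by
    rw [(hasSum_norm_expCoeff_sq P).tsum_eq]
    refine integral_exp_pos (integrable_of_continuous ?_)
    exact (continuous_const.mul (Complex.continuous_re.comp
      (P.continuous.comp (map_continuous (fourier 2))))).rexp
  rw [hexp] at hLM
  have hlog : Real.log (∑' n, ‖expCoeff P n‖ ^ 2) ≤ S := (Real.log_le_iff_le_exp hpos).2 hLM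
  rw [hint, Complex.ofReal_re] at h
  linarith

theorem expCoeff_C_mul_X (a : ℂ) (n : ℕ) : expCoeff (C a * X) n = a ^ n / n.factorial := by
  induction n with
  | zero => rw [expCoeff_zero] <;> simp
  | succ n ih =>
    have h := expCoeff_succ (C a * X) n
    rw [Finset.sum_eq_single 0] at h
    · have hn : ((n + 1 : ℕ) : ℂ) ≠ 0 := by exact_mod_cast n.succ_ne_zero
      have hf : (n.factorial : ℂ) ≠ 0 := by exact_mod_cast n.factorial_ne_zero
      simp only [coeff_C_mul, zero_add, coeff_X_one, mul_one, Nat.cast_one, one_mul, Nat.sub_zero,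
        ih] at h
      rw [Nat.factorial_succ]
      push_cast at h hn ⊢
      field_simp at h ⊢
      rw [pow_succ, mul_comm (a ^ n), ← h]
    · intro i _ hi
      rw [coeff_C_mul, coeff_X_of_ne_one (by omega)]; simp
    · simp

/-- A strict improvement of the logarithmic Hardy–Littlewood–Sobolev inequality for the
leading mode. -/
theorem two_mul_sub_log_le_entropy {q : ProbabilityMeasure Torus}
    (hq : InformationTheory.klDiv (q : Measure Torus) volume ≠ ⊤) :
    2 * ‖mode q 0‖ ^ 2 - Real.log (Real.exp (‖mode q 0‖ ^ 2) - ‖mode q 0‖ ^ 4 / 4) ≤ entropy q := by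
  set r := ‖mode q 0‖ with hr
  set P : ℂ[X] := C (starRingEnd ℂ (mode q 0)) * X with hP
  have hn : ∀ n, ‖expCoeff P n‖ ^ 2 = (r ^ 2) ^ n / (n.factorial : ℝ) ^ 2 := by
    intro n
    rw [hP, expCoeff_C_mul_X, norm_div, norm_pow, RCLike.norm_conj, RCLike.norm_natCast, div_pow,
      ← pow_mul, ← pow_mul, mul_comm]
  have h1 := hasSum_norm_expCoeff_sq P
  set I := ∫ θ : Torus, Real.exp (2 * (P.eval (fourier 2 θ)).re)
  have h2 : HasSum (fun n : ℕ => (r ^ 2) ^ n / n.factorial) (Real.exp (r ^ 2)) := by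
    rw [Real.exp_eq_exp_ℝ]
    exact NormedSpace.expSeries_div_hasSum_exp (r ^ 2)
  -- With P linear the exponential integral is Σ r^{2n}/(n!)², termwise at most exp(r²) = Σ
  -- r^{2n}/n!. Keeping only the gap at n = 2 gains r⁴/2 − r⁴/4 = r⁴/4.
  have h3 := le_hasSum (h2.sub h1) 2 fun n _ => by
    rw [hn, sub_nonneg]
    have : (1 : ℝ) ≤ n.factorial := by exact_mod_cast n.factorial_pos
    gcongr
    nlinarith
  rw [hn] at h3
  norm_num at h3
  have h := re_integral_eval_sub_log_le_entropy hq P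
  have hpos : 0 < ∑' n, ‖expCoeff P n‖ ^ 2 := by
    refine h1.summable.tsum_pos (fun _ => by positivity) 0 ?_
    rw [hn]; simp
  have hint : ∫ θ, P.eval (fourier 2 θ) ∂(q : Measure Torus) = ((r ^ 2 : ℝ) : ℂ) := by
    simp only [hP, eval_mul, eval_C, eval_X]
    rw [integral_const_mul]
    have := Complex.conj_mul' (mode q 0)
    push_cast
    rw [← this]
    simp [mode]
  rw [hint, Complex.ofReal_re] at h
  have hle : Real.log (∑' n, ‖expCoeff P n‖ ^ 2) ≤ Real.log (Real.exp (r ^ 2) - r ^ 4 / 4) := by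
    refine Real.log_le_log hpos ?_
    rw [h1.tsum_eq]
    nlinarith
  linarith

end Modes

/-! ### Fourier series of the kernel and the linear stability threshold. -/

section FourierSeries

/-- The kernel is invariant under translation by 1/2, whereas an odd character changes sign. -/
theorem fourierCoeff_doiOnsager_of_odd {n : ℤ} (hn : Odd n) :
    fourierCoeff (fun θ : Torus => (doiOnsager θ : ℂ)) n = 0 := by
  have hshift : ∀ θ : Torus, doiOnsager (θ + ((1 / 2 : ℝ) : Torus)) = doiOnsager θ := by
    intro θ
    induction θ using QuotientAddGroup.induction_on with
    | H x =>
      have : ((x : Torus) + ((1 / 2 : ℝ) : Torus)) = ((x + 1 / 2 : ℝ) : Torus) := rfl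
      change doiOnsager ((x : Torus) + ((1 / 2 : ℝ) : Torus)) = doiOnsager (x : Torus)
      rw [this, doiOnsager_coe, doiOnsager_coe, mul_add,
        show 2 * Real.pi * (1 / 2) = Real.pi by ring, Real.sin_add_pi, abs_neg]
  have hhalf : (fourier (-n) ((1 / 2 : ℝ) : Torus) : ℂ) = -1 := by
    obtain ⟨k, rfl⟩ := hn
    rw [fourier_coe_apply]
    push_cast
    rw [show (2 * (Real.pi : ℂ) * Complex.I * -(2 * (k : ℂ) + 1) * (1 / 2) / 1) =
      ((-k : ℤ) : ℂ) * (2 * Real.pi * Complex.I) + -(Real.pi * Complex.I) by push_cast; ring,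
      Complex.exp_add, Complex.exp_int_mul_two_pi_mul_I, Complex.exp_neg, Complex.exp_pi_mul_I]
    norm_num
  have h := integral_add_right_eq_self (μ := (AddCircle.haarAddCircle : Measure Torus))
    (fun θ : Torus => (fourier (-n) θ : ℂ) • (doiOnsager θ : ℂ)) ((1 / 2 : ℝ) : Torus)
  have h2 : ∀ θ : Torus, (fourier (-n) (θ + ((1 / 2 : ℝ) : Torus)) : ℂ) •
      (doiOnsager (θ + ((1 / 2 : ℝ) : Torus)) : ℂ) = -((fourier (-n) θ : ℂ) • (doiOnsager θ : ℂ)) := by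
    intro θ
    rw [hshift, fourier_apply, smul_add, AddCircle.toCircle_add, Circle.coe_mul, ← fourier_apply,
      ← fourier_apply, hhalf]
    simp
  simp only [h2] at h
  rw [integral_neg] at h
  rw [fourierCoeff]
  exact self_eq_neg.1 h.symm

theorem integral_exp_mul_sin {n : ℤ} (hn : (n : ℂ) ^ 2 - 1 ≠ 0) (a b : ℝ) :
    ∫ x in a..b, Complex.exp (-(2 * Real.pi * Complex.I * n * x)) * Complex.sin (2 * Real.pi * x) =
      (Complex.exp (-(2 * Real.pi * Complex.I * n * b)) *
        (Complex.cos (2 * Real.pi * b) + Complex.I * n * Complex.sin (2 * Real.pi * b)) -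
      Complex.exp (-(2 * Real.pi * Complex.I * n * a)) *
        (Complex.cos (2 * Real.pi * a) + Complex.I * n * Complex.sin (2 * Real.pi * a))) /
        (2 * Real.pi * ((n : ℂ) ^ 2 - 1)) := by
  have hpi : (Real.pi : ℂ) ≠ 0 := by exact_mod_cast Real.pi_ne_zero
  have hd : ∀ x : ℝ, HasDerivAt (fun x : ℝ => Complex.exp (-(2 * Real.pi * Complex.I * n * x)) *
      (Complex.cos (2 * Real.pi * x) + Complex.I * n * Complex.sin (2 * Real.pi * x)) /
        (2 * Real.pi * ((n : ℂ) ^ 2 - 1)))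
      (Complex.exp (-(2 * Real.pi * Complex.I * n * x)) * Complex.sin (2 * Real.pi * x)) x := by
    intro x
    have hid : HasDerivAt (fun z : ℂ => z) 1 x := hasDerivAt_id _
    have h1 := ((hid.const_mul (2 * Real.pi * Complex.I * n)).neg).cexp
    have h2 := (hid.const_mul (2 * Real.pi : ℂ)).ccos
    have h3 := ((hid.const_mul (2 * Real.pi : ℂ)).csin).const_mul (Complex.I * n)
    have h4 := ((h1.mul (h2.add h3)).div_const (2 * Real.pi * ((n : ℂ) ^ 2 - 1))).comp_ofReal
    refine h4.congr_deriv ?_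
    rw [div_eq_iff (mul_ne_zero (mul_ne_zero two_ne_zero hpi) hn)]
    simp only [Pi.add_apply, Pi.neg_apply]
    ring_nf
    rw [Complex.I_sq]
    ring
  rw [intervalIntegral.integral_eq_sub_of_hasDerivAt (fun x _ => hd x)
    (Continuous.intervalIntegrable (by fun_prop) _ _)]
  ring

theorem fourierCoeff_doiOnsager_of_even (k : ℤ) :
    fourierCoeff (fun θ : Torus => (doiOnsager θ : ℂ)) (2 * k) =
      ((2 / (Real.pi * (4 * k ^ 2 - 1)) : ℝ) : ℂ) := by
  have hpi : (Real.pi : ℂ) ≠ 0 := by exact_mod_cast Real.pi_ne_zero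
  have hn : (((2 * k : ℤ) : ℂ) ^ 2 - 1) ≠ 0 := by
    have : ((2 * k) ^ 2 - 1 : ℤ) ≠ 0 := by
      intro h
      have : 2 * (2 * k ^ 2) = 1 := by linarith
      omega
    exact_mod_cast this
  rw [fourierCoeff_eq_intervalIntegral _ _ 0]
  have hint : ∀ a b : ℝ, IntervalIntegrable (fun x : ℝ =>
      (fourier (-(2 * k)) (x : Torus) : ℂ) • (doiOnsager (x : Torus) : ℂ)) volume a b := by
    intro a b
    refine Continuous.intervalIntegrable ?_ _ _
    have h1 : Continuous fun x : ℝ => (fourier (-(2 * k)) (x : Torus) : ℂ) :=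
      (map_continuous _).comp (AddCircle.continuous_mk' 1)
    have h2 : Continuous fun x : ℝ => doiOnsager (x : Torus) :=
      (map_continuous _).comp (AddCircle.continuous_mk' 1)
    exact h1.smul (Complex.continuous_ofReal.comp h2)
  have hexp : ∀ x : ℝ, (fourier (-(2 * k)) (x : Torus) : ℂ) =
      Complex.exp (-(2 * Real.pi * Complex.I * (2 * k : ℤ) * x)) := by
    intro x
    rw [fourier_coe_apply]
    congr 1
    push_cast
    ring
  -- Split at 1/2, where the sine changes sign; each half has an explicit antiderivative.
  rw [← intervalIntegral.integral_add_adjacent_intervals (hint 0 (1 / 2)) (hint (1 / 2) (0 + 1))]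
  have h1 : ∫ x in (0 : ℝ)..(1 / 2), (fourier (-(2 * k)) (x : Torus) : ℂ) • (doiOnsager (x : Torus) : ℂ) =
      ∫ x in (0 : ℝ)..(1 / 2), -(Complex.exp (-(2 * Real.pi * Complex.I * (2 * k : ℤ) * x)) *
        Complex.sin (2 * Real.pi * x)) := by
    refine intervalIntegral.integral_congr fun x hx => ?_
    rw [Set.uIcc_of_le (by norm_num)] at hx
    have : 0 ≤ Real.sin (2 * Real.pi * x) := Real.sin_nonneg_of_nonneg_of_le_pi
      (by have := Real.pi_pos; have := hx.1; positivity)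
      (by nlinarith [hx.2, Real.pi_pos])
    rw [hexp, doiOnsager_coe, abs_of_nonneg this]
    simp
  have h2 : ∫ x in (1 / 2 : ℝ)..(0 + 1), (fourier (-(2 * k)) (x : Torus) : ℂ) • (doiOnsager (x : Torus) : ℂ) =
      ∫ x in (1 / 2 : ℝ)..(0 + 1), Complex.exp (-(2 * Real.pi * Complex.I * (2 * k : ℤ) * x)) *
        Complex.sin (2 * Real.pi * x) := by
    refine intervalIntegral.integral_congr fun x hx => ?_
    rw [Set.uIcc_of_le (by norm_num)] at hx
    have : Real.sin (2 * Real.pi * x) ≤ 0 := by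
      have h := Real.sin_nonneg_of_nonneg_of_le_pi (x := 2 * Real.pi * x - Real.pi)
        (by nlinarith [hx.1, Real.pi_pos]) (by nlinarith [hx.2, Real.pi_pos])
      rw [Real.sin_sub_pi] at h
      linarith
    rw [hexp, doiOnsager_coe, abs_of_nonpos this]
    simp
  have e0 : Complex.exp (-(2 * Real.pi * Complex.I * (2 * k : ℤ) * ((0 : ℝ) : ℂ))) = 1 := by simp
  have e1 : Complex.exp (-(2 * Real.pi * Complex.I * (2 * k : ℤ) * ((1 / 2 : ℝ) : ℂ))) = 1 := by
    rw [← Complex.exp_int_mul_two_pi_mul_I (-k)]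
    congr 1; push_cast; ring
  have e2 : Complex.exp (-(2 * Real.pi * Complex.I * (2 * k : ℤ) * ((0 + 1 : ℝ) : ℂ))) = 1 := by
    rw [← Complex.exp_int_mul_two_pi_mul_I (-(2 * k))]
    congr 1; push_cast; ring
  have a0 : (2 * Real.pi * ((0 : ℝ) : ℂ)) = 0 := by simp
  have a1 : (2 * Real.pi * ((1 / 2 : ℝ) : ℂ)) = Real.pi := by push_cast; ring
  have a2 : (2 * Real.pi * ((0 + 1 : ℝ) : ℂ)) = 2 * Real.pi := by push_cast; ring
  rw [h1, h2, intervalIntegral.integral_neg, integral_exp_mul_sin hn, integral_exp_mul_sin hn,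
    e0, e1, e2, a0, a1, a2]
  simp only [Complex.cos_zero, Complex.sin_zero, Complex.cos_pi, Complex.sin_pi,
    Complex.cos_two_pi, Complex.sin_two_pi]
  push_cast at hn ⊢
  rw [show (4 * (k : ℂ) ^ 2 - 1) = (2 * k) ^ 2 - 1 by ring]
  rw [one_div, inv_one, one_smul]
  field_simp
  ring

theorem coeff_doiOnsager_two_mul (k : ℕ) :
    coeff doiOnsager (2 * k) = 2 / (Real.pi * (4 * k ^ 2 - 1)) := by
  rw [coeff, Nat.cast_mul, Nat.cast_ofNat, fourierCoeff_doiOnsager_of_even, Complex.ofReal_re,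
    Int.cast_natCast]

theorem coeff_doiOnsager_of_odd {k : ℕ} (hk : Odd k) : coeff doiOnsager k = 0 := by
  rw [coeff, fourierCoeff_doiOnsager_of_odd (by exact_mod_cast hk), Complex.zero_re]

theorem isLinearStabilityThreshold_doiOnsager :
    IsLinearStabilityThreshold doiOnsager (3 * Real.pi / 4) := by
  have hpi := Real.pi_pos
  refine ⟨2 / (3 * Real.pi), ⟨⟨2, by norm_num, ?_⟩, ?_⟩, by field_simp; ring⟩
  · have h := coeff_doiOnsager_two_mul 1
    norm_num at h
    rw [h, mul_comm Real.pi]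
    exact ⟨by positivity, rfl⟩
  · rintro x ⟨k, hk, hpos, rfl⟩
    rcases Nat.even_or_odd' k with ⟨j, rfl | rfl⟩
    · rw [coeff_doiOnsager_two_mul]
      have hj : (1 : ℝ) ≤ j := by exact_mod_cast (by omega : 1 ≤ j)
      rw [mul_comm 3]
      gcongr
      nlinarith
    · rw [coeff_doiOnsager_of_odd ⟨j, rfl⟩] at hpos
      exact absurd hpos (lt_irrefl _)

/-- Comparison with 2/n²; since π > 3, at n = 2k one has π(4k²−1) ≥ 4k² for k ≠ 0. Absolute
summability makes the Fourier series converge pointwise. -/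
theorem summable_fourierCoeff_doiOnsager :
    Summable (fourierCoeff (fun θ : Torus => (doiOnsager θ : ℂ))) := by
  have h := ((Real.summable_one_div_int_pow (p := 2)).2 (by norm_num)).mul_left 2
  refine h.of_norm_bounded_eventually ?_
  filter_upwards [(Set.finite_singleton (0 : ℤ)).compl_mem_cofinite] with n hn
  rcases Int.even_or_odd' n with ⟨k, rfl | rfl⟩
  · have hk : (1 : ℝ) ≤ (k : ℝ) ^ 2 := by
      have : k ≠ 0 := by rintro rfl; simp at hn
      exact_mod_cast Int.add_one_le_iff.2 (by positivity : 0 < k ^ 2)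
    rw [fourierCoeff_doiOnsager_of_even, Complex.norm_real, Real.norm_of_nonneg]
    · rw [mul_one_div]
      push_cast
      refine div_le_div_of_nonneg_left zero_le_two (by nlinarith) ?_
      nlinarith [mul_nonneg (sub_nonneg.2 Real.pi_gt_three.le)
        (by linarith : 0 ≤ 4 * (k : ℝ) ^ 2 - 1)]
    · have : 0 ≤ 4 * (k : ℝ) ^ 2 - 1 := by linarith
      have := Real.pi_pos
      positivity
  · rw [fourierCoeff_doiOnsager_of_odd ⟨k, rfl⟩, norm_zero]
    positivity

/-- The weight of the mode `2 (j + 1)` in the cosine series of the Doi–Onsager kernel. -/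
noncomputable def weight (j : ℕ) : ℝ := 4 / (Real.pi * (4 * (j + 1) ^ 2 - 1))

theorem weight_nonneg (j : ℕ) : 0 ≤ weight j := by
  have : (0 : ℝ) ≤ 4 * ((j : ℝ) + 1) ^ 2 - 1 := by
    have : (0 : ℝ) ≤ j := j.cast_nonneg
    nlinarith
  have := Real.pi_pos
  rw [weight]
  positivity

/-- The cosine series of the Doi–Onsager kernel. -/
theorem hasSum_doiOnsager (θ : Torus) :
    HasSum (fun j : ℕ => weight j * (fourier (2 * (j + 1 : ℕ) : ℤ) θ : ℂ).re)
      (doiOnsager θ + 2 / Real.pi) := by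
  have h1 := has_pointwise_sum_fourier_series_of_summable (T := (1 : ℝ))
    (f := ⟨fun θ : Torus => (doiOnsager θ : ℂ), by fun_prop⟩) summable_fourierCoeff_doiOnsager θ
  simp only [ContinuousMap.coe_mk] at h1
  have h2 := h1.nat_add_neg
  have h3 := (Function.Injective.hasSum_iff (g := fun j : ℕ => 2 * j)
    (fun a b hab => by simpa using hab) (fun n hn => by
      have hodd : Odd n := by
        rw [← Nat.not_even_iff_odd]
        rintro ⟨j, rfl⟩
        exact hn ⟨j, by simp; ring⟩
      have hodd' : Odd (n : ℤ) := by exact_mod_cast hodd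
      rw [fourierCoeff_doiOnsager_of_odd hodd', fourierCoeff_doiOnsager_of_odd hodd'.neg]
      simp)).2 h2
  -- Pairing n with −n counted the constant mode twice; removing the term n = 0 leaves W − Ŵ(0) = W
  -- + 2/π.
  have h4 := (hasSum_nat_add_iff' 1).2 h3
  have hz : fourierCoeff (fun θ : Torus => (doiOnsager θ : ℂ)) 0 = ((-(2 / Real.pi) : ℝ) : ℂ) := by
    rw [← mul_zero 2, fourierCoeff_doiOnsager_of_even, ← div_neg]
    norm_num
  simp only [Finset.sum_range_one, Function.comp_apply, mul_zero, Nat.cast_zero, neg_zero,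
    fourier_zero, hz] at h4
  have h5 := Complex.hasSum_re h4
  convert h5 using 1
  · funext j
    have e1 := fourierCoeff_doiOnsager_of_even (j + 1 : ℕ)
    have e2 := fourierCoeff_doiOnsager_of_even (-(j + 1 : ℕ))
    have e3 : ((2 * (j + 1) : ℕ) : ℤ) = 2 * ((j + 1 : ℕ) : ℤ) := by push_cast; ring
    rw [e3, ← mul_neg, e1, e2, mul_neg, fourier_neg]
    simp only [smul_eq_mul, Complex.add_re, Complex.re_ofReal_mul, Complex.conj_re, weight]
    push_cast
    rw [neg_sq]
    ring
  · simp only [smul_eq_mul, mul_one, Complex.sub_re, Complex.add_re, Complex.ofReal_re]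
    ring

theorem summable_weight : Summable weight := by
  have h := (hasSum_doiOnsager 0).summable
  simpa using h

end FourierSeries

/-! ### Interaction energy in terms of modes; weak continuity and positive definiteness. -/

section Energy

/-- The mean-field potential `W * q`. -/
noncomputable def potential (q : ProbabilityMeasure Torus) (θ : Torus) : ℝ :=
  ∫ θ', doiOnsager (θ - θ') ∂(q : Measure Torus)

theorem hasSum_potential (q : ProbabilityMeasure Torus) (θ : Torus) :
    HasSum (fun j => weight j * (fourier (2 * (j + 1 : ℕ) : ℤ) θ * starRingEnd ℂ (mode q j)).re)
      (potential q θ + 2 / Real.pi) := by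
  have hle : ∀ (j : ℕ) (x : Torus), ‖weight j * (fourier (2 * (j + 1 : ℕ) : ℤ) x : ℂ).re‖ ≤ weight j := by
    intro j x
    rw [norm_mul, Real.norm_of_nonneg (weight_nonneg j)]
    refine mul_le_of_le_one_right (weight_nonneg j) ?_
    exact (Complex.abs_re_le_norm _).trans (norm_fourier_apply _ _).le
  have h := hasSum_integral_of_summable_integral_norm (μ := (q : Measure Torus))
    (F := fun j θ' => weight j * (fourier (2 * (j + 1 : ℕ) : ℤ) (θ - θ') : ℂ).re)
    (fun j => integrable_of_continuous (by fun_prop))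
    (summable_weight.of_nonneg_of_le (fun _ => integral_nonneg fun _ => norm_nonneg _) fun j => by
      refine (integral_mono (integrable_of_continuous (by fun_prop)) (integrable_const (weight j))
        fun x => hle j _).trans ?_
      simp)
  have h2 : ∀ θ', ∑' j, weight j * (fourier (2 * (j + 1 : ℕ) : ℤ) (θ - θ') : ℂ).re =
      doiOnsager (θ - θ') + 2 / Real.pi := fun θ' => (hasSum_doiOnsager _).tsum_eq
  simp only [h2] at h
  rw [integral_add (integrable_of_continuous (by fun_prop)) (integrable_const _)] at h
  simp only [integral_const, probReal_univ, one_smul] at h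
  refine h.congr_fun fun j => ?_
  rw [integral_const_mul]
  congr 1
  have h3 : ∀ θ' : Torus, (fourier (2 * (j + 1 : ℕ) : ℤ) (θ - θ') : ℂ) =
      fourier (2 * (j + 1 : ℕ) : ℤ) θ * starRingEnd ℂ (fourier (2 * (j + 1 : ℕ) : ℤ) θ') := by
    intro θ'
    rw [fourier_apply, smul_sub, sub_eq_add_neg, AddCircle.toCircle_add, Circle.coe_mul,
      fourier_neg', fourier_apply, fourier_apply]
  simp only [h3]
  have h4 := integral_re (𝕜 := ℂ) (μ := (q : Measure Torus)) (f := fun θ' : Torus =>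
    (fourier (2 * (j + 1 : ℕ) : ℤ) θ : ℂ) * starRingEnd ℂ (fourier (2 * (j + 1 : ℕ) : ℤ) θ'))
    (integrable_of_continuous (by fun_prop))
  rw [integral_const_mul, integral_conj] at h4
  exact h4.symm

theorem continuous_mode (j : ℕ) : Continuous fun q => mode q j := by
  have hre : Continuous fun q : ProbabilityMeasure Torus =>
      ∫ θ, (fourier (2 * (j + 1 : ℕ) : ℤ) θ : ℂ).re ∂(q : Measure Torus) :=
    continuous_iff_continuousAt.2 fun q =>
      (ProbabilityMeasure.tendsto_iff_forall_integral_tendsto.1 tendsto_id)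
        (BoundedContinuousFunction.mkOfCompact
          ⟨fun θ => (fourier (2 * (j + 1 : ℕ) : ℤ) θ : ℂ).re, by fun_prop⟩)
  have him : Continuous fun q : ProbabilityMeasure Torus =>
      ∫ θ, (fourier (2 * (j + 1 : ℕ) : ℤ) θ : ℂ).im ∂(q : Measure Torus) :=
    continuous_iff_continuousAt.2 fun q =>
      (ProbabilityMeasure.tendsto_iff_forall_integral_tendsto.1 tendsto_id)
        (BoundedContinuousFunction.mkOfCompact
          ⟨fun θ => (fourier (2 * (j + 1 : ℕ) : ℤ) θ : ℂ).im, by fun_prop⟩)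
  have h : ∀ q, mode q j =
      ((∫ θ, (fourier (2 * (j + 1 : ℕ) : ℤ) θ : ℂ).re ∂(q : Measure Torus) : ℝ) : ℂ) +
      ((∫ θ, (fourier (2 * (j + 1 : ℕ) : ℤ) θ : ℂ).im ∂(q : Measure Torus) : ℝ) : ℂ) * Complex.I :=
    fun q => (integral_re_add_im (𝕜 := ℂ) (integrable_of_continuous (map_continuous _))).symm
  simp only [h]
  fun_prop

theorem norm_weight_mul_re_le {q : ProbabilityMeasure Torus} {z : ℂ} (hz : ‖z‖ ≤ 1) (j : ℕ) :
    ‖weight j * (z * starRingEnd ℂ (mode q j)).re‖ ≤ weight j := by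
  rw [norm_mul, Real.norm_of_nonneg (weight_nonneg j)]
  refine mul_le_of_le_one_right (weight_nonneg j) ?_
  refine (Complex.abs_re_le_norm _).trans ?_
  rw [norm_mul, RCLike.norm_conj]
  exact mul_le_one₀ hz (norm_nonneg _) (norm_mode_le q j)

/-- Uniform convergence of the cosine series, dominated by the weights. Joint continuity is what
makes the dual functional weakly continuous. -/
theorem continuous_potential :
    Continuous fun x : ProbabilityMeasure Torus × Torus => potential x.1 x.2 := by
  have h : ∀ x : ProbabilityMeasure Torus × Torus, potential x.1 x.2 =
      ∑' j, weight j * (fourier (2 * (j + 1 : ℕ) : ℤ) x.2 * starRingEnd ℂ (mode x.1 j)).re -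
        2 / Real.pi := fun x => eq_sub_of_add_eq (hasSum_potential x.1 x.2).tsum_eq.symm
  simp only [h]
  refine Continuous.sub (continuous_tsum (fun j => ?_) summable_weight fun j x =>
    norm_weight_mul_re_le (norm_fourier_apply _ _).le j) continuous_const
  have h1 := (continuous_mode j).comp (continuous_fst (X := ProbabilityMeasure Torus) (Y := Torus))
  have h2 := (map_continuous (fourier (2 * (j + 1 : ℕ) : ℤ))).comp
    (continuous_snd (X := ProbabilityMeasure Torus) (Y := Torus))
  exact continuous_const.mul (Complex.continuous_re.comp
    (h2.mul (Complex.continuous_conj.comp h1)))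

theorem continuous_potential_right (q : ProbabilityMeasure Torus) : Continuous (potential q) :=
  continuous_potential.comp (continuous_const.prodMk continuous_id)

theorem hasSum_integral_potential (p q : ProbabilityMeasure Torus) :
    HasSum (fun j => weight j * (mode q j * starRingEnd ℂ (mode p j)).re)
      (∫ θ, potential p θ ∂(q : Measure Torus) + 2 / Real.pi) := by
  have h := hasSum_integral_of_summable_integral_norm (μ := (q : Measure Torus))
    (F := fun j θ => weight j *
      (fourier (2 * (j + 1 : ℕ) : ℤ) θ * starRingEnd ℂ (mode p j)).re)
    (fun j => integrable_of_continuous (by fun_prop))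
    (summable_weight.of_nonneg_of_le (fun _ => integral_nonneg fun _ => norm_nonneg _) fun j => by
      refine (integral_mono (integrable_of_continuous (by fun_prop)) (integrable_const (weight j))
        fun x => norm_weight_mul_re_le (norm_fourier_apply _ _).le j).trans ?_
      simp)
  simp only [(hasSum_potential p _).tsum_eq] at h
  rw [integral_add (integrable_of_continuous (continuous_potential_right p))
    (integrable_const _)] at h
  simp only [integral_const, probReal_univ, one_smul] at h
  refine h.congr_fun fun j => ?_
  rw [integral_const_mul]
  congr 1
  have h4 := integral_re (𝕜 := ℂ) (μ := (q : Measure Torus)) (f := fun θ : Torus =>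
    (fourier (2 * (j + 1 : ℕ) : ℤ) θ : ℂ) * starRingEnd ℂ (mode p j))
    (integrable_of_continuous (by fun_prop))
  rw [integral_mul_const] at h4
  exact h4.symm

theorem interactionEnergy_eq (q : ProbabilityMeasure Torus) :
    interactionEnergy doiOnsager q = ∫ θ, potential q θ ∂(q : Measure Torus) := rfl

theorem hasSum_interactionEnergy (q : ProbabilityMeasure Torus) :
    HasSum (fun j => weight j * ‖mode q j‖ ^ 2)
      (interactionEnergy doiOnsager q + 2 / Real.pi) := by
  have h := hasSum_integral_potential q q
  have h2 : ∀ j, (mode q j * starRingEnd ℂ (mode q j)).re = ‖mode q j‖ ^ 2 := fun j => by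
    rw [Complex.mul_conj']
    norm_cast
  simp only [h2] at h
  exact h

theorem continuous_interactionEnergy : Continuous (interactionEnergy doiOnsager) := by
  have h : ∀ q, interactionEnergy doiOnsager q = ∑' j, weight j * ‖mode q j‖ ^ 2 - 2 / Real.pi :=
    fun q => eq_sub_of_add_eq (hasSum_interactionEnergy q).tsum_eq.symm
  rw [funext h]
  refine Continuous.sub (continuous_tsum (fun j => ?_) summable_weight fun j q => ?_)
    continuous_const
  · exact continuous_const.mul ((continuous_mode j).norm.pow 2)
  · rw [Real.norm_of_nonneg (mul_nonneg (weight_nonneg j) (by positivity))]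
    exact mul_le_of_le_one_right (weight_nonneg j)
      (pow_le_one₀ (norm_nonneg _) (norm_mode_le q j))

theorem interactionEnergy_nonpos (q : ProbabilityMeasure Torus) :
    interactionEnergy doiOnsager q ≤ 0 := by
  refine integral_nonpos fun θ => integral_nonpos fun θ' => ?_
  change doiOnsager (θ - θ') ≤ 0
  induction θ - θ' using QuotientAddGroup.induction_on with
  | H x => exact (doiOnsager_coe x).trans_le (neg_nonpos.2 (abs_nonneg _))

/-- The interaction energy is positive definite on differences of probability measures. -/
theorem two_mul_integral_potential_le (p q : ProbabilityMeasure Torus) :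
    2 * ∫ θ, potential p θ ∂(q : Measure Torus) ≤
      interactionEnergy doiOnsager p + interactionEnergy doiOnsager q := by
  have h := hasSum_le (fun j => ?_) ((hasSum_integral_potential p q).mul_left 2)
    ((hasSum_interactionEnergy p).add (hasSum_interactionEnergy q))
  · linarith
  · have h1 : 2 * (mode q j * starRingEnd ℂ (mode p j)).re ≤ ‖mode p j‖ ^ 2 + ‖mode q j‖ ^ 2 := by
      have h2 := Complex.re_le_norm (mode q j * starRingEnd ℂ (mode p j))
      rw [norm_mul, RCLike.norm_conj] at h2
      nlinarith [sq_nonneg (‖mode p j‖ - ‖mode q j‖)]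
    nlinarith [mul_le_mul_of_nonneg_left h1 (weight_nonneg j)]

theorem mode_uniform (j : ℕ) : mode uniform j = 0 := by
  have := integral_fourier (2 * (j + 1 : ℕ) : ℤ)
  rw [if_neg (by omega)] at this
  exact this

theorem interactionEnergy_uniform : interactionEnergy doiOnsager uniform = -(2 / Real.pi) := by
  have h := hasSum_interactionEnergy uniform
  simp only [mode_uniform, norm_zero] at h
  have h0 : HasSum (fun j => weight j * (0 : ℝ) ^ 2) 0 := by simp [hasSum_zero]
  have := h.unique h0
  linarith

end Energy

/-! ### Critical inequality, its stability, and continuity of the transition. -/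

section Minimizers

open InformationTheory

theorem freeEnergy_eq_coe {q : ProbabilityMeasure Torus}
    (hq : klDiv (q : Measure Torus) volume ≠ ⊤) (K : ℝ) :
    freeEnergy doiOnsager K q = ((entropy q - K * interactionEnergy doiOnsager q : ℝ) : EReal) := by
  rw [freeEnergy, entropy, EReal.coe_sub, EReal.coe_ennreal_toReal hq]

theorem freeEnergy_eq_top {q : ProbabilityMeasure Torus}
    (hq : klDiv (q : Measure Torus) volume = ⊤) (K : ℝ) :
    freeEnergy doiOnsager K q = ⊤ := by
  rw [freeEnergy, hq, EReal.coe_ennreal_top, EReal.top_sub_coe]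

theorem klDiv_uniform : klDiv (uniform : Measure Torus) volume = 0 := klDiv_self _

theorem entropy_uniform : entropy uniform = 0 := by
  rw [entropy, klDiv_uniform, ENNReal.toReal_zero]

theorem klDiv_uniform_ne_top : klDiv (uniform : Measure Torus) volume ≠ ⊤ := by
  rw [klDiv_uniform]; exact ENNReal.zero_ne_top

theorem entropy_nonneg (q : ProbabilityMeasure Torus) : 0 ≤ entropy q := ENNReal.toReal_nonneg

theorem eq_uniform_of_entropy_le_zero {q : ProbabilityMeasure Torus}
    (hq : klDiv (q : Measure Torus) volume ≠ ⊤) (h : entropy q ≤ 0) : q = uniform := by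
  have h0 : klDiv (q : Measure Torus) volume = 0 := by
    rcases (ENNReal.toReal_eq_zero_iff _).1 (le_antisymm h (entropy_nonneg q)) with h | h
    · exact h
    · exact absurd h hq
  have h1 : (q : Measure Torus) = volume := klDiv_eq_zero_iff.1 h0
  exact Subtype.ext h1

/-- The uniform distribution has finite free energy, so minimizers have finite entropy and real
arithmetic suffices. -/
theorem isGlobalMinimizer_iff {K : ℝ} {q : ProbabilityMeasure Torus} :
    IsGlobalMinimizer doiOnsager K q ↔ klDiv (q : Measure Torus) volume ≠ ⊤ ∧
      ∀ p : ProbabilityMeasure Torus, klDiv (p : Measure Torus) volume ≠ ⊤ →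
        entropy q - K * interactionEnergy doiOnsager q ≤
          entropy p - K * interactionEnergy doiOnsager p := by
  constructor
  · intro h
    have hq : klDiv (q : Measure Torus) volume ≠ ⊤ := by
      intro hq
      have := h uniform
      rw [freeEnergy_eq_top hq, freeEnergy_eq_coe klDiv_uniform_ne_top, top_le_iff] at this
      exact EReal.coe_ne_top _ this
    refine ⟨hq, fun p hp => ?_⟩
    have := h p
    rwa [freeEnergy_eq_coe hq, freeEnergy_eq_coe hp, EReal.coe_le_coe_iff] at this
  · rintro ⟨hq, h⟩ p
    by_cases hp : klDiv (p : Measure Torus) volume = ⊤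
    · rw [freeEnergy_eq_top hp]; exact le_top
    · rw [freeEnergy_eq_coe hq, freeEnergy_eq_coe hp, EReal.coe_le_coe_iff]
      exact h p hp

/-- The interaction energy relative to that of the uniform distribution, in units of the critical
coupling strength. -/
noncomputable def excess (q : ProbabilityMeasure Torus) : ℝ :=
  3 * Real.pi / 4 * (interactionEnergy doiOnsager q + 2 / Real.pi)

theorem excess_uniform : excess uniform = 0 := by
  rw [excess, interactionEnergy_uniform]; ring

theorem mul_interactionEnergy (K : ℝ) (q : ProbabilityMeasure Torus) :
    K * interactionEnergy doiOnsager q =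
      K / (3 * Real.pi / 4) * excess q - K * (2 / Real.pi) := by
  have := Real.pi_ne_zero
  rw [excess]
  field_simp
  ring

theorem hasSum_excess (q : ProbabilityMeasure Torus) :
    HasSum (fun j : ℕ => 3 / (4 * ((j : ℝ) + 1) ^ 2 - 1) * ‖mode q j‖ ^ 2) (excess q) := by
  refine ((hasSum_interactionEnergy q).mul_left (3 * Real.pi / 4)).congr_fun fun j => ?_
  have := Real.pi_ne_zero
  have : 4 * ((j : ℝ) + 1) ^ 2 - 1 ≠ 0 := by
    have : (0 : ℝ) ≤ j := j.cast_nonneg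
    nlinarith
  rw [weight]
  field_simp

theorem excess_nonneg (q : ProbabilityMeasure Torus) : 0 ≤ excess q := by
  refine (hasSum_excess q).nonneg fun j => ?_
  have : (0 : ℝ) ≤ 4 * ((j : ℝ) + 1) ^ 2 - 1 := by
    have : (0 : ℝ) ≤ j := j.cast_nonneg
    nlinarith
  positivity

/-- Because W ≤ 0. A bound uniform in q controls all minimizers near the threshold at once. -/
theorem excess_le (q : ProbabilityMeasure Torus) : excess q ≤ 3 / 2 := by
  have h := interactionEnergy_nonpos q
  have hpi := Real.pi_pos
  rw [excess, mul_add]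
  have : 3 * Real.pi / 4 * (2 / Real.pi) = 3 / 2 := by field_simp; ring
  rw [this]
  nlinarith

theorem norm_mode_zero_sq_le_excess (q : ProbabilityMeasure Torus) :
    ‖mode q 0‖ ^ 2 ≤ excess q := by
  have h := le_hasSum (hasSum_excess q) 0 fun j _ => by
    have : (0 : ℝ) ≤ 4 * ((j : ℝ) + 1) ^ 2 - 1 := by
      have : (0 : ℝ) ≤ j := j.cast_nonneg
      nlinarith
    positivity
  norm_num at h
  exact h

theorem norm_mode_zero_sq_le_entropy {q : ProbabilityMeasure Torus}
    (hq : klDiv (q : Measure Torus) volume ≠ ⊤) : ‖mode q 0‖ ^ 2 ≤ entropy q := by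
  simpa using sum_norm_mode_sq_div_le_entropy hq 1

/-- With k = j + 1, the coefficient 3/(4k²−1) is at most 1/(2k) for k ≥ 2 and equals 1 at k = 1,
where the extra half of |m_1|² makes up the difference. -/
theorem excess_le_half_add {q : ProbabilityMeasure Torus}
    (hq : klDiv (q : Measure Torus) volume ≠ ⊤) :
    excess q ≤ (entropy q + ‖mode q 0‖ ^ 2) / 2 := by
  refine le_of_tendsto' (hasSum_excess q).tendsto_sum_nat fun N => ?_
  have h1 : ∀ j ∈ Finset.range N, 3 / (4 * ((j : ℝ) + 1) ^ 2 - 1) * ‖mode q j‖ ^ 2 ≤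
      (‖mode q j‖ ^ 2 / (j + 1 : ℕ) + if j = 0 then ‖mode q 0‖ ^ 2 else 0) / 2 := by
    intro j _
    rcases j with _ | j
    · norm_num
    · rw [if_neg (Nat.succ_ne_zero j), add_zero, div_div, div_eq_mul_one_div, mul_comm]
      refine mul_le_mul_of_nonneg_left ?_ (by positivity)
      have hj : (0 : ℝ) ≤ j := j.cast_nonneg
      push_cast
      rw [mul_one_div, ← one_div, div_le_div_iff₀ (by nlinarith) (by positivity)]
      nlinarith
  refine (Finset.sum_le_sum h1).trans ?_
  rw [← Finset.sum_div, Finset.sum_add_distrib, Finset.sum_ite_eq']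
  have h2 := sum_norm_mode_sq_div_le_entropy hq N
  split_ifs <;> nlinarith [sq_nonneg ‖mode q 0‖]

theorem excess_le_entropy {q : ProbabilityMeasure Torus}
    (hq : klDiv (q : Measure Torus) volume ≠ ⊤) : excess q ≤ entropy q := by
  linarith [excess_le_half_add hq, norm_mode_zero_sq_le_entropy hq]

/-- Stability of the inequality `excess q ≤ entropy q`. -/
theorem entropy_le_of_le_excess_add {q : ProbabilityMeasure Torus}
    (hq : klDiv (q : Measure Torus) volume ≠ ⊤) {ε : ℝ}
    (h : entropy q ≤ excess q + ε) : entropy q ≤ √(24 * ε) + 2 * ε := by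
  set r := ‖mode q 0‖ with hr
  have hr0 : 0 ≤ r := norm_nonneg _
  have hr1 : r ≤ 1 := norm_mode_le q 0
  have h1 := excess_le_half_add hq
  have h2 : entropy q ≤ r ^ 2 + 2 * ε := by linarith
  have h3 := two_mul_sub_log_le_entropy hq
  have hr4 : r ^ 4 ≤ 1 := pow_le_one₀ hr0 hr1
  have hexp1 : 1 ≤ Real.exp (r ^ 2) := Real.one_le_exp (by positivity)
  have h4 : r ^ 2 - 2 * ε ≤ Real.log (Real.exp (r ^ 2) - r ^ 4 / 4) := by linarith
  rw [Real.le_log_iff_exp_le (by linarith), sub_eq_add_neg, Real.exp_add] at h4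
  have h5 := Real.add_one_le_exp (-(2 * ε))
  have h6 : Real.exp (r ^ 2) ≤ 3 :=
    (Real.exp_le_exp.2 (by nlinarith : r ^ 2 ≤ 1)).trans Real.exp_one_lt_three.le
  have hε : 0 ≤ ε := by linarith [excess_le_entropy hq]
  -- From exp(r²)(1 − 2ε) ≤ exp(r²) − r⁴/4 follows r⁴ ≤ 8ε exp(r²), and exp(r²) ≤ 3.
  have h7 : r ^ 4 ≤ 24 * ε := by nlinarith
  have h8 : r ^ 2 ≤ √(24 * ε) := Real.le_sqrt_of_sq_le (by nlinarith)
  linarith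

/-- Comparison of a minimizer with the uniform distribution. -/
theorem IsGlobalMinimizer.entropy_le {K : ℝ} {q : ProbabilityMeasure Torus}
    (h : IsGlobalMinimizer doiOnsager K q) :
    klDiv (q : Measure Torus) volume ≠ ⊤ ∧ entropy q ≤ K / (3 * Real.pi / 4) * excess q := by
  obtain ⟨hq, h⟩ := isGlobalMinimizer_iff.1 h
  refine ⟨hq, ?_⟩
  have := h uniform klDiv_uniform_ne_top
  rw [mul_interactionEnergy, mul_interactionEnergy, excess_uniform, entropy_uniform] at this
  linarith

theorem isGlobalMinimizer_uniform {K : ℝ} (hK : K ≤ 3 * Real.pi / 4) :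
    IsGlobalMinimizer doiOnsager K uniform := by
  refine isGlobalMinimizer_iff.2 ⟨klDiv_uniform_ne_top, fun p hp => ?_⟩
  rw [mul_interactionEnergy, mul_interactionEnergy, excess_uniform, entropy_uniform]
  have h1 : K / (3 * Real.pi / 4) ≤ 1 := (div_le_one (by positivity)).2 hK
  nlinarith [excess_le_entropy hp, excess_nonneg p]

theorem IsGlobalMinimizer.eq_uniform {K : ℝ} (hK : K ≤ 3 * Real.pi / 4)
    {q : ProbabilityMeasure Torus} (h : IsGlobalMinimizer doiOnsager K q) : q = uniform := by
  obtain ⟨hq, h⟩ := h.entropy_le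
  have h1 : K / (3 * Real.pi / 4) ≤ 1 := (div_le_one (by positivity)).2 hK
  have h2 := entropy_le_of_le_excess_add hq (ε := 0) (by nlinarith [excess_nonneg q])
  exact eq_uniform_of_entropy_le_zero hq (by simpa using h2)

theorem l1DistUniform_eq (q : ProbabilityMeasure Torus) :
    l1DistUniform q = ENNReal.ofReal
      (∫ θ, |((q : Measure Torus).rnDeriv volume θ).toReal - 1| ∂(volume : Measure Torus)) := by
  have h : Integrable (fun θ : Torus => ((q : Measure Torus).rnDeriv volume θ).toReal - 1) volume :=
    Measure.integrable_toReal_rnDeriv.sub (integrable_const _)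
  rw [l1DistUniform, eLpNorm_one_eq_lintegral_enorm, ← ofReal_integral_norm_eq_lintegral_enorm h]
  rfl

theorem l1DistUniform_le {q : ProbabilityMeasure Torus}
    (hq : klDiv (q : Measure Torus) volume ≠ ⊤) {φ : ℝ} (hφ : 0 < φ) (hφ1 : φ ≤ 1)
    (h : entropy q ≤ φ) : l1DistUniform q ≤ ENNReal.ofReal (2 * √φ) := by
  rw [l1DistUniform_eq]
  refine ENNReal.ofReal_le_ofReal ?_
  -- The choice t = √φ balances φ/t against t.
  have h1 := mul_integral_abs_rnDeriv_sub_one_le hq (Real.sqrt_nonneg φ) (Real.sqrt_le_one.2 hφ1)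
  rw [Real.sq_sqrt hφ.le] at h1
  refine le_of_mul_le_mul_left (h1.trans ?_) (Real.sqrt_pos.2 hφ)
  have := Real.mul_self_sqrt hφ.le
  rw [entropy] at h
  linarith

theorem tendsto_l1DistUniform {q : ℝ → ProbabilityMeasure Torus}
    (hq : ∀ K, 3 * Real.pi / 4 < K → IsGlobalMinimizer doiOnsager K (q K)) :
    Tendsto (fun K => l1DistUniform (q K)) (𝓝[>] (3 * Real.pi / 4)) (𝓝 0) := by
  set Kc : ℝ := 3 * Real.pi / 4 with hKc
  have hKpos : 0 < Kc := by positivity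
  -- A minimizer satisfies Ent ≤ (K/K_c)·E = E + (K/K_c − 1)·E, and E ≤ 3/2.
  set ε : ℝ → ℝ := fun K => (K / Kc - 1) * (3 / 2) with hε
  set φ : ℝ → ℝ := fun K => √(24 * ε K) + 2 * ε K with hφ
  have hφc : Continuous φ := by fun_prop
  have hφ0 : φ Kc = 0 := by simp [hφ, hε, div_self hKpos.ne']
  have hεpos : ∀ K, Kc < K → 0 < ε K := fun K hK =>
    mul_pos (sub_pos.2 ((one_lt_div hKpos).2 hK)) (by norm_num)
  have hφpos : ∀ K, Kc < K → 0 < φ K := fun K hK => by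
    have := hεpos K hK
    positivity
  have hlim : Tendsto (fun K => ENNReal.ofReal (2 * √(φ K))) (𝓝[>] Kc) (𝓝 0) := by
    have h1 : Continuous fun K => ENNReal.ofReal (2 * √(φ K)) :=
      ENNReal.continuous_ofReal.comp (by fun_prop)
    have h2 := (h1.tendsto Kc).mono_left (nhdsWithin_le_nhds (s := Set.Ioi Kc))
    simpa [hφ0] using h2
  have hsmall : ∀ᶠ K in 𝓝[>] Kc, φ K ≤ 1 := by
    have h2 := (hφc.tendsto Kc).mono_left (nhdsWithin_le_nhds (s := Set.Ioi Kc))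
    rw [hφ0] at h2
    exact (h2.eventually_lt_const one_pos).mono fun _ h => h.le
  refine tendsto_of_tendsto_of_tendsto_of_le_of_le' tendsto_const_nhds hlim
    (Eventually.of_forall fun _ => zero_le) ?_
  filter_upwards [hsmall, self_mem_nhdsWithin] with K hK1 hK
  obtain ⟨hfin, hent⟩ := (hq K hK).entropy_le
  refine l1DistUniform_le hfin (hφpos K hK) hK1 (entropy_le_of_le_excess_add hfin ?_)
  have h1 := excess_le (q K)
  have h2 : 0 < K / Kc - 1 := sub_pos.2 ((one_lt_div hKpos).2 hK)
  rw [← hKc] at hent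
  simp only [hε]
  nlinarith [mul_le_mul_of_nonneg_left h1 h2.le]

theorem isContinuousTransition_doiOnsager :
    IsContinuousTransition doiOnsager (3 * Real.pi / 4) :=
  ⟨⟨uniform, isGlobalMinimizer_uniform le_rfl, fun _ h => IsGlobalMinimizer.eq_uniform le_rfl h⟩,
    fun _ hq => (tendsto_l1DistUniform hq).limsup_eq⟩

end Minimizers

/-! ### Existence of minimizers by duality. -/

section Existence

open InformationTheory

theorem exists_bound_potential (q : ProbabilityMeasure Torus) (K : ℝ) :
    ∃ C, ∀ θ, |2 * K * potential q θ| ≤ C := by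
  have hc : Continuous fun θ => |2 * K * potential q θ| :=
    (continuous_const.mul (continuous_potential_right q)).abs
  obtain ⟨C, hC⟩ := (isCompact_range hc).bddAbove
  exact ⟨C, fun θ => hC ⟨θ, rfl⟩⟩

/-- The Gibbs measure of the mean-field potential of `q`. -/
noncomputable def gibbs (K : ℝ) (q : ProbabilityMeasure Torus) : ProbabilityMeasure Torus :=
  ⟨(volume : Measure Torus).tilted fun θ => 2 * K * potential q θ,
    isProbabilityMeasure_tilted (integrable_of_continuous
      (continuous_const.mul (continuous_potential_right q)).rexp)⟩

/-- The dual functional, which lies between `freeEnergy K (gibbs K q)` and `freeEnergy K q`. -/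
noncomputable def dualEnergy (K : ℝ) (q : ProbabilityMeasure Torus) : ℝ :=
  K * interactionEnergy doiOnsager q -
    Real.log (∫ θ : Torus, Real.exp (2 * K * potential q θ))

theorem continuous_dualEnergy (K : ℝ) : Continuous (dualEnergy K) := by
  have h1 : Continuous fun q : ProbabilityMeasure Torus =>
      ∫ θ : Torus, Real.exp (2 * K * potential q θ) := by
    have hc : Continuous fun x : ProbabilityMeasure Torus × Torus =>
        Real.exp (2 * K * potential x.1 x.2) :=
      (continuous_const.mul continuous_potential).rexp
    have := continuous_parametric_integral_of_continuous (μ := (volume : Measure Torus))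
      (f := fun (q : ProbabilityMeasure Torus) θ => Real.exp (2 * K * potential q θ))
      hc isCompact_univ
    simpa using this
  refine (continuous_const.mul continuous_interactionEnergy).sub (h1.log fun q => ?_)
  exact (integral_exp_pos (integrable_of_continuous
    (continuous_const.mul (continuous_potential_right q)).rexp)).ne'

/-- Donsker–Varadhan with test function 2K(W ∗ q). -/
theorem dualEnergy_le {q : ProbabilityMeasure Torus}
    (hq : klDiv (q : Measure Torus) volume ≠ ⊤) (K : ℝ) :
    dualEnergy K q ≤ entropy q - K * interactionEnergy doiOnsager q := by
  have hc : Continuous fun θ => 2 * K * potential q θ :=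
    continuous_const.mul (continuous_potential_right q)
  have h := integral_sub_log_integral_exp_le_klDiv hq (integrable_of_continuous hc)
    (integrable_of_continuous hc.rexp)
  rw [integral_const_mul, ← interactionEnergy_eq] at h
  rw [dualEnergy, entropy]
  linarith

theorem klDiv_gibbs_ne_top (K : ℝ) (q : ProbabilityMeasure Torus) :
    klDiv (gibbs K q : Measure Torus) volume ≠ ⊤ := by
  obtain ⟨C, hC⟩ := exists_bound_potential q K
  exact (klDiv_tilted (continuous_const.mul (continuous_potential_right q)).measurable hC).1

/-- The Gibbs entropy is explicit, and the gap is K times the interaction energy of q − `gibbs K q`,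
nonnegative by positive definiteness. -/
theorem entropy_gibbs_sub_le_dualEnergy {K : ℝ} (hK : 0 ≤ K) (q : ProbabilityMeasure Torus) :
    entropy (gibbs K q) - K * interactionEnergy doiOnsager (gibbs K q) ≤ dualEnergy K q := by
  obtain ⟨C, hC⟩ := exists_bound_potential q K
  have h := (klDiv_tilted (ν := (volume : Measure Torus))
    (continuous_const.mul (continuous_potential_right q)).measurable hC).2
  have h1 : entropy (gibbs K q) = 2 * K * ∫ θ, potential q θ ∂(gibbs K q : Measure Torus) -
      Real.log (∫ θ : Torus, Real.exp (2 * K * potential q θ)) := by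
    rw [← integral_const_mul]
    exact h
  have h2 := mul_le_mul_of_nonneg_left (two_mul_integral_potential_le q (gibbs K q)) hK
  rw [h1, dualEnergy]
  linarith

/-- A minimizer p of the continuous dual functional on the compact space of probability measures
yields the minimizer `gibbs K p`; lower semicontinuity of the entropy is not needed. -/
theorem exists_isGlobalMinimizer {K : ℝ} (hK : 0 ≤ K) :
    ∃ q, IsGlobalMinimizer doiOnsager K q := by
  obtain ⟨p, -, hp⟩ := isCompact_univ.exists_isMinOn ⟨uniform, Set.mem_univ _⟩
    (continuous_dualEnergy K).continuousOn
  refine ⟨gibbs K p, isGlobalMinimizer_iff.2 ⟨klDiv_gibbs_ne_top K p, fun q hq => ?_⟩⟩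
  exact (entropy_gibbs_sub_le_dualEnergy hK p).trans
    ((hp (Set.mem_univ q)).trans (dualEnergy_le hq K))

end Existence

/-! ### Instability of the uniform distribution above the threshold. -/

section Supercritical

open InformationTheory

theorem entropy_withDensity_le {q : ProbabilityMeasure Torus} {g : Torus → ℝ} (hg : Continuous g)
    {ε : ℝ} (hε : ε ≤ 1 / 2) (hgε : ∀ θ, |g θ| ≤ ε)
    (hq : (q : Measure Torus) = volume.withDensity fun θ => ENNReal.ofReal (1 + g θ)) :
    klDiv (q : Measure Torus) volume ≠ ⊤ ∧ entropy q ≤ (∫ θ, g θ ^ 2) / 2 + 4 * ε ^ 3 := by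
  have hbd : ∀ θ, |g θ| ≤ 1 / 2 := fun θ => (hgε θ).trans hε
  have hac : (q : Measure Torus) ≪ volume := hq ▸ withDensity_absolutelyContinuous _ _
  have hkl : klDiv (q : Measure Torus) volume = ENNReal.ofReal (∫ θ, klFun (1 + g θ)) := by
    rw [klDiv_eq_lintegral_klFun_of_ac hac, ofReal_integral_eq_lintegral_ofReal]
    · refine lintegral_congr_ae ?_
      have h := Measure.rnDeriv_withDensity (volume : Measure Torus)
        (f := fun θ => ENNReal.ofReal (1 + g θ)) (by fun_prop)
      rw [← hq] at h
      filter_upwards [h] with θ hθ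
      rw [hθ, ENNReal.toReal_ofReal (by linarith [(abs_le.1 (hbd θ)).1])]
    · exact integrable_of_continuous (continuous_klFun.comp (continuous_const.add hg))
    · exact ae_of_all _ fun θ => klFun_nonneg (by linarith [(abs_le.1 (hbd θ)).1])
  refine ⟨hkl ▸ ENNReal.ofReal_ne_top, ?_⟩
  have hg2 : Integrable (fun θ => g θ ^ 2 / 2) (volume : Measure Torus) :=
    integrable_of_continuous (by fun_prop)
  have hle : ∫ θ, klFun (1 + g θ) ≤ ∫ θ : Torus, (g θ ^ 2 / 2 + 4 * ε ^ 3) := by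
    refine integral_mono
      (integrable_of_continuous (continuous_klFun.comp (continuous_const.add hg)))
      (hg2.add (integrable_const _)) fun θ => ?_
    have := pow_le_pow_left₀ (abs_nonneg _) (hgε θ) 3
    linarith [klFun_one_add_le (hbd θ)]
  rw [integral_add hg2 (integrable_const _), integral_div] at hle
  rw [entropy, hkl, ENNReal.toReal_ofReal]
  · simpa using hle
  · exact integral_nonneg fun θ => klFun_nonneg (by linarith [(abs_le.1 (hbd θ)).1])

/-- A small perturbation of the uniform distribution in the most unstable mode. -/
theorem exists_entropy_le_excess_ge {ε : ℝ} (hε0 : 0 ≤ ε) (hε : ε ≤ 1 / 4) :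
    ∃ q : ProbabilityMeasure Torus, klDiv (q : Measure Torus) volume ≠ ⊤ ∧
      entropy q ≤ ε ^ 2 + 32 * ε ^ 3 ∧ ε ^ 2 ≤ excess q := by
  -- The factor 2ε makes the leading mode of 1 + g equal to ε. Then ∫ g² = 2ε² and |g| ≤ 2ε ≤ 1/2,
  -- so the cubic error is 4(2ε)³ = 32ε³.
  set g : Torus → ℝ := fun θ => 2 * ε * (fourier 2 θ : ℂ).re with hg
  have hgc : Continuous g := by fun_prop
  have hgε : ∀ θ, |g θ| ≤ 2 * ε := fun θ => by
    rw [hg, abs_mul, abs_of_nonneg (by positivity)]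
    refine mul_le_of_le_one_right (by positivity) ?_
    exact (Complex.abs_re_le_norm _).trans (norm_fourier_apply _ _).le
  have hpos : ∀ θ, 0 ≤ 1 + g θ := fun θ => by linarith [(abs_le.1 (hgε θ)).1]
  have hgC : ∀ θ, (g θ : ℂ) = ε * (fourier 2 θ + fourier (-2) θ) := fun θ => by
    rw [fourier_neg, Complex.add_conj, hg]
    push_cast
    ring
  have hint : ∀ n : ℤ, Integrable (fun θ : Torus => (fourier n θ : ℂ)) volume := fun n =>
    integrable_of_continuous (map_continuous _)
  have hmul : ∀ n : ℤ, ∫ θ : Torus, (g θ : ℂ) * fourier n θ =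
      ε * ((if 2 + n = 0 then 1 else 0) + if -2 + n = 0 then 1 else 0) := by
    intro n
    have : ∀ θ : Torus, (g θ : ℂ) * fourier n θ =
        ε * (fourier (2 + n) θ + fourier (-2 + n) θ) := fun θ => by
      rw [hgC, fourier_add, fourier_add]; ring
    simp only [this]
    rw [integral_const_mul, integral_add (hint _) (hint _), integral_fourier, integral_fourier]
  have hg0 : ∫ θ : Torus, g θ = 0 := by
    have h := hmul 0
    simp only [fourier_zero, mul_one] at h
    rw [integral_complex_ofReal] at h
    norm_num at h
    exact h
  have hg2 : ∫ θ : Torus, g θ ^ 2 = 2 * ε ^ 2 := by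
    have : ∀ θ : Torus, ((g θ ^ 2 : ℝ) : ℂ) =
        ε * (g θ * fourier 2 θ + g θ * fourier (-2) θ) := fun θ => by
      rw [pow_two, Complex.ofReal_mul]
      nth_rewrite 2 [hgC]
      ring
    have h : ∫ θ : Torus, ((g θ ^ 2 : ℝ) : ℂ) = ((2 * ε ^ 2 : ℝ) : ℂ) := by
      simp only [this]
      rw [integral_const_mul, integral_add (integrable_of_continuous (by fun_prop))
        (integrable_of_continuous (by fun_prop)), hmul, hmul]
      norm_num
      ring
    rw [integral_complex_ofReal] at h
    exact_mod_cast h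
  have hmass : (volume.withDensity fun θ : Torus => ENNReal.ofReal (1 + g θ)) Set.univ = 1 := by
    rw [withDensity_apply _ MeasurableSet.univ, Measure.restrict_univ,
      ← ofReal_integral_eq_lintegral_ofReal (integrable_of_continuous (by fun_prop))
        (ae_of_all _ hpos), integral_add (integrable_const _) (integrable_of_continuous hgc), hg0]
    simp
  let q : ProbabilityMeasure Torus :=
    ⟨volume.withDensity fun θ : Torus => ENNReal.ofReal (1 + g θ), ⟨hmass⟩⟩
  have hq : (q : Measure Torus) = volume.withDensity fun θ => ENNReal.ofReal (1 + g θ) := rfl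
  obtain ⟨h1, h2⟩ := entropy_withDensity_le hgc (by linarith) hgε hq
  have hmode : mode q 0 = ε := by
    rw [mode, hq, integral_withDensity_eq_integral_toReal_smul (by fun_prop)
      (ae_of_all _ fun _ => ENNReal.ofReal_lt_top)]
    have : ∀ θ : Torus, (ENNReal.ofReal (1 + g θ)).toReal • (fourier (2 * (0 + 1 : ℕ) : ℤ) θ : ℂ) =
        fourier 2 θ + g θ * fourier 2 θ := fun θ => by
      rw [ENNReal.toReal_ofReal (hpos θ), Complex.real_smul]
      push_cast
      ring
    simp only [this]
    rw [integral_add (hint _) (integrable_of_continuous (by fun_prop)), hmul, integral_fourier]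
    norm_num
  refine ⟨q, h1, ?_, ?_⟩
  · rw [hg2] at h2
    linarith
  · have h := norm_mode_zero_sq_le_excess q
    rw [hmode, Complex.norm_real, Real.norm_of_nonneg hε0] at h
    exact h

theorem not_isGlobalMinimizer_uniform {K : ℝ} (hK : 3 * Real.pi / 4 < K) :
    ¬ IsGlobalMinimizer doiOnsager K uniform := by
  intro h
  have hKpos : 0 < 3 * Real.pi / 4 := by positivity
  set δ : ℝ := K / (3 * Real.pi / 4) - 1 with hδ
  have hδpos : 0 < δ := sub_pos.2 ((one_lt_div hKpos).2 hK)
  -- With ε ≤ δ/64 the error 32ε³ is at most half of the gain δε².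
  set ε : ℝ := min (1 / 4) (δ / 64) with hε
  have hεpos : 0 < ε := lt_min (by norm_num) (by positivity)
  obtain ⟨q, hq, hent, hexc⟩ := exists_entropy_le_excess_ge hεpos.le (min_le_left _ _)
  have h1 := (isGlobalMinimizer_iff.1 h).2 q hq
  rw [mul_interactionEnergy, mul_interactionEnergy, excess_uniform, entropy_uniform,
    show K / (3 * Real.pi / 4) = 1 + δ by rw [hδ]; ring] at h1
  have h2 : ε ≤ δ / 64 := min_le_right _ _
  have h3 : (1 + δ) * ε ^ 2 ≤ (1 + δ) * excess q := by gcongr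
  have h4 : 32 * ε ^ 3 ≤ δ / 2 * ε ^ 2 := by nlinarith [pow_pos hεpos 2]
  have h5 : 0 < δ * ε ^ 2 := by positivity
  nlinarith

theorem isCriticalCoupling_doiOnsager : IsCriticalCoupling doiOnsager (3 * Real.pi / 4) where
  pos := by positivity
  subcritical K _ hK q :=
    ⟨fun h => h.eq_uniform hK.le, fun h => h ▸ isGlobalMinimizer_uniform hK.le⟩
  critical := isGlobalMinimizer_uniform le_rfl
  supercritical K hK := by
    have hKpos : 0 < 3 * Real.pi / 4 := by positivity
    obtain ⟨q, hq⟩ := exists_isGlobalMinimizer (hKpos.le.trans hK.le)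
    exact ⟨q, fun h => not_isGlobalMinimizer_uniform hK (h ▸ hq), hq⟩

end Supercritical

end MeanField

theorem theorem1p5 :
    MeanField.IsCriticalCoupling MeanField.doiOnsager (3 * Real.pi / 4) ∧
    MeanField.IsLinearStabilityThreshold MeanField.doiOnsager (3 * Real.pi / 4) ∧
    MeanField.IsContinuousTransition MeanField.doiOnsager (3 * Real.pi / 4) :=
  ⟨MeanField.isCriticalCoupling_doiOnsager, MeanField.isLinearStabilityThreshold_doiOnsager,
    MeanField.isContinuousTransition_doiOnsager⟩
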